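/- **Setting.** Let $\mathcal P$ be a set of data distributions, and for $P\in\mathcal P$ let $\Theta_I(P)=[\theta_l(P),\theta_u(P)]$, $\theta_l(P)\le\theta_u(P)$, be the identified set. For each sample size $N\ge 1$ an estimator is a vector of real random variables $(\hat\theta_l,\hat\theta_u,\hat\sigma_l,\hat\sigma_u,\hat\rho)$ depending on $N$. It satisfies the *ordered bounds setup* (OBS) with parameters $(\theta_l(P),\theta_u(P),\sigma_l(P),\sigma_u(P),\rho(P))$, where $\rho(P)\in[-1,1]$, on $\mathcal P$ with constants $0<\underline\sigma\le\overline\sigma<\infty$ and $\overline\Delta<\infty$ if, for all $P\in\mathcal P$, $\sigma_l(P),\sigma_u(P)\in[\underline\sigma,\overline\sigma]$ and $\theta_u(P)-\theta_l(P)\le\overline\Delta$, and (a) $P(\hat\theta_l\le\hat\theta_u)=1$ for all $P\in\mathcal P$ and $N\ge1$; (b) uniformly in $P\in\mathcal P$, $\sqrt N(\hat\theta_l-\theta_l(P),\hat\theta_u-\theta_u(P))$ converges in distribution to $N(0,\Sigma(P))$, where $\Sigma(P)$ has diagonal entries $\sigma_l(P)^2,\sigma_u(P)^2$ and off-diagonal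 entries $\rho(P)\sigma_l(P)\sigma_u(P)$ (that is, the expectation of every bounded continuous function converges uniformly in $P\in\mathcal P$); (c) uniformly in $P\in\mathcal P$, $(\hat\sigma_l,\hat\sigma_u,\hat\rho)$ converges in probability to $(\sigma_l(P),\sigma_u(P),\rho(P))$. For $\alpha\in(0,\tfrac12)$ the confidence interval of an estimator is $$CI_2=\Big[\hat\theta_l-\frac{\hat\sigma_l c_l}{\sqrt N},\ \hat\theta_u+\frac{\hat\sigma_u c_u}{\sqrt N}\Big],$$ where, whenever $\hat\sigma_l,\hat\sigma_u>0$, $(c_l,c_u)\in\mathbb R^2$ is a solution, chosen arbitrarily (for each sample) if there are several, of: minimize $\hat\sigma_l c_l+\hat\sigma_u c_u$ subject to $$\Pr\Big(-c_l\le z_1,\ \hat\rho z_1\le c_u+\tfrac{\sqrt N(\hat\theta_u-\hat\theta_l)}{\hat\sigma_u}+\sqrt{1-\hat\rho^2}\,z_2\Big)\ge1-\alpha,$$ $$\Pr\Big(-c_l-\tfrac{\sqrt N(\hat\theta_u-\hat\theta_l)}{\hat\sigma_l}+\sqrt{1-\hat\rho^2}\,z_2\le\hat\rho z_1,\ z_1\le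 c_u\Big)\ge1-\alpha,$$ with $z_1,z_2$ independent standard normal, the estimates held fixed, and $\sqrt{1-\hat\rho^2}$ read as $0$ if $|\hat\rho|>1$. No condition is imposed on $(c_l,c_u)$ on samples where $\hat\sigma_l\le0$ or $\hat\sigma_u\le0$. **Theorem.** Let $\alpha\in(0,\tfrac12)$. Let two estimators, marked $E$ and $I$, satisfy OBS on the same $\mathcal P$ with the same $\theta_l(P),\theta_u(P)$ and constants, and with $(\sigma_l^E(P),\sigma_u^E(P),\rho^E(P))$ and $(\sigma_l^I(P),\sigma_u^I(P),\rho^I(P))$ respectively, and suppose $\sigma_l^E(P)\le\sigma_l^I(P)$ and $\sigma_u^E(P)\le\sigma_u^I(P)$ for all $P\in\mathcal P$. Let $CI_2^E$, $CI_2^I$ be the corresponding confidence intervals. (i) For every sequence $(P_N,\theta_N)$ with $P_N\in\mathcal P$ and $\theta_N\notin\Theta_I(P_N)$, $$\liminf_{N\to\infty}\big(P_N(\theta_N\in CI_2^E)-P_N(\theta_N\in CI_2^I)\big)\le0.\qquad(*)$$ (ii) The inequality in $(*)$ is strict for every such sequence for which either $\sigma_l^E(P_N)$ and $\sigma_l^I(P_N)$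 converge to limits $s^E<s^I$ and $\sqrt N(\theta_l(P_N)-\theta_N)$ converges to a limit in $(0,\infty)$, or $\sigma_u^E(P_N)$ and $\sigma_u^I(P_N)$ converge to limits $s^E<s^I$ and $\sqrt N(\theta_N-\theta_u(P_N))$ converges to a limit in $(0,\infty)$. (iii) If $\sigma_l^E(P)<\sigma_l^I(P)$ or $\sigma_u^E(P)<\sigma_u^I(P)$ for some $P\in\mathcal P$, then there is a sequence $(P_N,\theta_N)$ with $P_N\in\mathcal P$, $\theta_N\notin\Theta_I(P_N)$ for which $(*)$ is strict. -/

import Mathlib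

open MeasureTheory ProbabilityTheory Filter Topology
open scoped BoundedContinuousFunction

noncomputable section

/-- A sequence of estimators `(θ̂_l, θ̂_u, σ̂_l, σ̂_u, ρ̂)`, indexed by the sample size, as random
variables on the space `Ω` that carries the data. -/
structure BoundsEstimator (Ω : Type*) [MeasurableSpace Ω] where
  /-- estimator of the lower bound -/
  θl : ℕ → Ω → ℝ
  /-- estimator of the upper bound -/
  θu : ℕ → Ω → ℝ
  /-- estimator of the asymptotic standard deviation of the lower bound estimator -/
  σl : ℕ → Ω → ℝ
  /-- estimator of the asymptotic standard deviation of the upper bound estimator -/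
  σu : ℕ → Ω → ℝ
  /-- estimator of the asymptotic correlation -/
  ρ : ℕ → Ω → ℝ
  measurable_θl : ∀ N, Measurable (θl N)
  measurable_θu : ∀ N, Measurable (θu N)
  measurable_σl : ∀ N, Measurable (σl N)
  measurable_σu : ∀ N, Measurable (σu N)
  measurable_ρ : ∀ N, Measurable (ρ N)

/-- The asymptotic standard deviations and correlation, as functions of the data distribution. -/
structure AsymptoticParams (Ω : Type*) [MeasurableSpace Ω] where
  /-- asymptotic standard deviation of the lower bound estimator -/
  σl : ProbabilityMeasure Ω → ℝ
  /-- asymptotic standard deviation of the upper bound estimator -/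
  σu : ProbabilityMeasure Ω → ℝ
  /-- asymptotic correlation of the two bound estimators -/
  ρ : ProbabilityMeasure Ω → ℝ

/-- The covariance matrix with standard deviations `σl`, `σu` and correlation `ρ`. -/
def covMat (σl σu ρ : ℝ) : Matrix (Fin 2) (Fin 2) ℝ :=
  !![σl ^ 2, ρ * σl * σu; ρ * σl * σu, σu ^ 2]

/-- Convergence in distribution of the random vectors `X N P` under `P` to the laws `L P`,
uniformly in `P ∈ Ps`: expectations of each bounded continuous function converge uniformly. -/
def UniformlyTendstoInLaw {Ω : Type*} [MeasurableSpace Ω] (Ps : Set (ProbabilityMeasure Ω))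
    (X : ℕ → ProbabilityMeasure Ω → Ω → EuclideanSpace ℝ (Fin 2))
    (L : ProbabilityMeasure Ω → Measure (EuclideanSpace ℝ (Fin 2))) : Prop :=
  ∀ f : EuclideanSpace ℝ (Fin 2) →ᵇ ℝ,
    TendstoUniformlyOn (fun N (P : ProbabilityMeasure Ω) => ∫ ω, f (X N P ω) ∂(P : Measure Ω))
      (fun P : ProbabilityMeasure Ω => ∫ x, f x ∂(L P)) atTop Ps

/-- Convergence in probability of the estimators `X N` to `x P` under `P`, uniformly in
`P ∈ Ps`. -/
def UniformlyConsistent {Ω : Type*} [MeasurableSpace Ω] (Ps : Set (ProbabilityMeasure Ω))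
    (X : ℕ → Ω → ℝ) (x : ProbabilityMeasure Ω → ℝ) : Prop :=
  ∀ ε > 0, TendstoUniformlyOn
    (fun N (P : ProbabilityMeasure Ω) => (P : Measure Ω).real {ω | ε ≤ |X N ω - x P|}) (fun _ => 0) atTop Ps

/-- The ordered bounds setup: the estimator `e` is ordered, uniformly asymptotically normal, and
has uniformly consistent standard deviation and correlation estimators, over the set `Ps` of data
distributions, with the identified set `[θl P, θu P]` of length at most `Δ` and asymptotic
standard deviations in `[σlo, σhi]`. -/
structure OrderedBoundsSetup {Ω : Type*} [MeasurableSpace Ω] (Ps : Set (ProbabilityMeasure Ω))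
    (θl θu : ProbabilityMeasure Ω → ℝ) (σlo σhi Δ : ℝ)
    (e : BoundsEstimator Ω) (p : AsymptoticParams Ω) : Prop where
  σlo_pos : 0 < σlo
  σlo_le_σhi : σlo ≤ σhi
  ordered : ∀ P ∈ Ps, ∀ N, 0 < N → ∀ᵐ ω ∂(P : Measure Ω), e.θl N ω ≤ e.θu N ω
  asymptoticallyNormal : UniformlyTendstoInLaw Ps
    (fun N P ω => !₂[√(N : ℝ) * (e.θl N ω - θl P), √(N : ℝ) * (e.θu N ω - θu P)])
    (fun P => multivariateGaussian 0 (covMat (p.σl P) (p.σu P) (p.ρ P)))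
  σl_mem : ∀ P ∈ Ps, p.σl P ∈ Set.Icc σlo σhi
  σu_mem : ∀ P ∈ Ps, p.σu P ∈ Set.Icc σlo σhi
  ρ_mem : ∀ P ∈ Ps, p.ρ P ∈ Set.Icc (-1) 1
  length_le : ∀ P ∈ Ps, θu P - θl P ≤ Δ
  consistent_σl : UniformlyConsistent Ps e.σl p.σl
  consistent_σu : UniformlyConsistent Ps e.σu p.σu
  consistent_ρ : UniformlyConsistent Ps e.ρ p.ρ

/-- The law of a pair `(z₁, z₂)` of independent standard normal variables. -/
def stdNormalPair : Measure (ℝ × ℝ) := (gaussianReal 0 1).prod (gaussianReal 0 1)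

/-- The pairs `c = (c_l, c_u)` that satisfy the two coverage constraints, where `δ` stands for
`√N (θ̂_u - θ̂_l)`. -/
def ci2Feasible (α δ σl σu ρ : ℝ) : Set (ℝ × ℝ) :=
  {c | 1 - α ≤ stdNormalPair.real
        {z | -c.1 ≤ z.1 ∧ ρ * z.1 ≤ c.2 + δ / σu + √(1 - ρ ^ 2) * z.2} ∧
      1 - α ≤ stdNormalPair.real
        {z | -c.1 - δ / σl + √(1 - ρ ^ 2) * z.2 ≤ ρ * z.1 ∧ z.1 ≤ c.2}}

/-- `c = (c_l, c_u)` minimizes `σ_l c_l + σ_u c_u` subject to the two coverage constraints. -/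
def IsCI2Solution (α δ σl σu ρ : ℝ) (c : ℝ × ℝ) : Prop :=
  c ∈ ci2Feasible α δ σl σu ρ ∧
    IsMinOn (fun c' : ℝ × ℝ => σl * c'.1 + σu * c'.2) (ci2Feasible α δ σl σu ρ) c

/-- `c N ω = (c_l, c_u)` is, for each sample, some solution of the minimization problem of the
estimator `e` (nothing is required where an estimated standard deviation is not positive). -/
def IsCI2CriticalValue {Ω : Type*} [MeasurableSpace Ω] (α : ℝ) (e : BoundsEstimator Ω)
    (c : ℕ → Ω → ℝ × ℝ) : Prop :=
  ∀ N ω, 0 < N → 0 < e.σl N ω → 0 < e.σu N ω →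
    IsCI2Solution α (√(N : ℝ) * (e.θu N ω - e.θl N ω)) (e.σl N ω) (e.σu N ω) (e.ρ N ω) (c N ω)

/-- The confidence interval with critical values `c`, for sample size `N` and data `ω`. -/
def ci2 {Ω : Type*} [MeasurableSpace Ω] (e : BoundsEstimator Ω) (c : ℕ → Ω → ℝ × ℝ)
    (N : ℕ) (ω : Ω) : Set ℝ :=
  Set.Icc (e.θl N ω - e.σl N ω * (c N ω).1 / √(N : ℝ))
    (e.θu N ω + e.σu N ω * (c N ω).2 / √(N : ℝ))

/-- The probability, under `P`, that the confidence interval for sample size `N` covers `θ`. -/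
def ci2Coverage {Ω : Type*} [MeasurableSpace Ω] (e : BoundsEstimator Ω) (c : ℕ → Ω → ℝ × ℝ)
    (N : ℕ) (P : ProbabilityMeasure Ω) (θ : ℝ) : ℝ :=
  (P : Measure Ω).real {ω | θ ∈ ci2 e c N ω}

end

/-! The liminf of a bounded sequence is at most its limit along any subsequence, so it suffices to
compare the two limiting coverages along one subsequence. The points lie infinitely often on one
side of the identified set, and reflection exchanges the sides, so let them lie below. By
compactness (`exists_regular_subseq`) the asymptotic parameters converge, and the scaled length D =
√N(θu - θl) and distance κ = √N(θl - θ) converge in [0, ∞]. If κ → ∞, both coverages vanish.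
Otherwise let κ → κ₀, let s be the limit of σl, and write Φ for `gcdf`.

If D → ∞, each constraint becomes one-sided: both critical values tend to the q with Φ(q) = 1 - α,
the upper end of the interval never binds, and the coverage tends to Φ(q - κ₀/s). This is monotone
in s, strictly if κ₀ > 0.

If D → D₀ < ∞, the ordering of the estimators bounds the scaled difference of their errors from
below. A nondegenerate normal limit is not bounded below, so the two standard deviations agree and
the correlation is 1 (`RegularSeq.degenerate`). Concavity of Φ on [0, ∞) makes the limiting
minimization problem uniquely solvable (`eq_of_limit_problem`): both critical values tend to the c
for which [-c, c + D₀/s] has normal mass 1 - α. The coverage tends to the mass of this interval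
shifted right by κ₀/s. A smaller s gives a larger d = D₀/s and a larger shift. Of two such intervals
of equal mass, the one that extends further right and less far left keeps at most as much mass after
a common shift (`shifted_mass_le_of_interval`), and a larger shift costs strictly more
(`strictAntiOn_shift`).

Convergence in probability is convergence along the filter `whp` on ℕ × Ω. The minimization problem
can then be treated deterministically, along arbitrary filters. -/

/-! ### The standard normal distribution function. -/

/-- The distribution function of the standard normal law. -/
noncomputable def gcdf (x : ℝ) : ℝ := (gaussianReal 0 1).real (Set.Iic x)

instance : NullSingletonClass (gaussianReal 0 1) := nullSingletonClass_gaussianReal one_ne_zero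

lemma gcdf_eq_integral (x : ℝ) : gcdf x = ∫ y in Set.Iic x, gaussianPDFReal 0 1 y := by
  rw [gcdf, measureReal_def, gaussianReal_apply_eq_integral 0 one_ne_zero,
    ENNReal.toReal_ofReal (integral_nonneg fun y => gaussianPDFReal_nonneg 0 1 y)]

lemma gcdf_sub (a b : ℝ) : gcdf b - gcdf a = ∫ y in a..b, gaussianPDFReal 0 1 y := by
  rw [gcdf_eq_integral, gcdf_eq_integral, intervalIntegral.integral_Iic_sub_Iic]
  · exact (integrable_gaussianPDFReal 0 1).integrableOn
  · exact (integrable_gaussianPDFReal 0 1).integrableOn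

lemma continuous_stdGaussianPDF : Continuous (gaussianPDFReal 0 1) := by
  unfold gaussianPDFReal
  fun_prop

lemma hasDerivAt_gcdf (x : ℝ) : HasDerivAt gcdf (gaussianPDFReal 0 1 x) x := by
  have h := intervalIntegral.integral_hasDerivAt_right
    (continuous_stdGaussianPDF.intervalIntegrable 0 x)
    continuous_stdGaussianPDF.stronglyMeasurable.stronglyMeasurableAtFilter
    continuous_stdGaussianPDF.continuousAt
  have h2 : gcdf = fun u => gcdf 0 + ∫ y in (0 : ℝ)..u, gaussianPDFReal 0 1 y := by
    funext u
    rw [← gcdf_sub]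
    ring
  rw [h2]
  exact h.const_add _

lemma continuous_gcdf : Continuous gcdf :=
  continuous_iff_continuousAt.2 fun x => (hasDerivAt_gcdf x).continuousAt

lemma strictMono_gcdf : StrictMono gcdf :=
  strictMono_of_deriv_pos fun x => by
    rw [(hasDerivAt_gcdf x).deriv]
    exact gaussianPDFReal_pos 0 1 x one_ne_zero

lemma tendsto_gcdf_atTop : Tendsto gcdf atTop (𝓝 1) := by
  have : gcdf = cdf (gaussianReal 0 1) := by
    funext x
    rw [cdf_eq_real]
    rfl
  rw [this]
  exact tendsto_cdf_atTop _

lemma tendsto_gcdf_atBot : Tendsto gcdf atBot (𝓝 0) := by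
  have : gcdf = cdf (gaussianReal 0 1) := by
    funext x
    rw [cdf_eq_real]
    rfl
  rw [this]
  exact tendsto_cdf_atBot _

lemma gcdf_lt_one (x : ℝ) : gcdf x < 1 :=
  (strictMono_gcdf (lt_add_one x)).trans_le measureReal_le_one

lemma stdGaussian_real_Ici (a : ℝ) : (gaussianReal 0 1).real (Set.Ici (-a)) = gcdf a := by
  have h := gaussianReal_map_neg (μ := 0) (v := 1)
  rw [neg_zero] at h
  have h2 : (gaussianReal 0 1).real (Set.Ici (-a))
      = ((gaussianReal 0 1).map (fun x => -x)).real (Set.Ici (-a)) := by rw [h]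
  rw [h2, map_measureReal_apply measurable_neg measurableSet_Ici, gcdf]
  congr 1
  ext x
  simp

lemma gcdf_neg (x : ℝ) : gcdf (-x) = 1 - gcdf x := by
  rw [← stdGaussian_real_Ici x, measureReal_congr (Ioi_ae_eq_Ici (a := -x)).symm, gcdf,
    ← Set.compl_Iic, probReal_compl_eq_one_sub measurableSet_Iic]
  ring

lemma gcdf_zero : gcdf 0 = 1 / 2 := by
  have := gcdf_neg 0
  rw [neg_zero] at this
  linarith

lemma stdGaussian_real_Icc {a b : ℝ} (h : a ≤ b) :
    (gaussianReal 0 1).real (Set.Icc a b) = gcdf b - gcdf a := by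
  rw [← measureReal_congr (Ioc_ae_eq_Icc (a := a) (b := b)), ← Set.Iic_sdiff_Iic,
    measureReal_sdiff (Set.Iic_subset_Iic.2 h) measurableSet_Iic]
  rfl

/-! ### Normal mass of shifted intervals. -/

lemma gaussianPDFReal_shift (y k : ℝ) :
    gaussianPDFReal 0 1 (y + k) = gaussianPDFReal 0 1 y * Real.exp (-(k * y) - k ^ 2 / 2) := by
  simp only [gaussianPDFReal, sub_zero, NNReal.coe_one, mul_one]
  rw [mul_assoc, ← Real.exp_add]
  ring_nf

/-- For y ≥ 0 the density ratio exp(-ky - k²/2) is at most exp(-k²/2); for y ≤ 0 it is at least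
that. The same constant thus separates what happens to pieces right and left of the origin. -/
lemma gcdf_shift_le {u v k : ℝ} (hu : 0 ≤ u) (huv : u ≤ v) (hk : 0 ≤ k) :
    gcdf (v + k) - gcdf (u + k) ≤ Real.exp (-(k ^ 2 / 2)) * (gcdf v - gcdf u) := by
  rw [gcdf_sub, gcdf_sub, ← intervalIntegral.integral_comp_add_right,
    ← intervalIntegral.integral_const_mul]
  refine intervalIntegral.integral_mono_on huv
    ((continuous_stdGaussianPDF.comp (continuous_add_const k)).intervalIntegrable _ _)
    ((continuous_const.mul continuous_stdGaussianPDF).intervalIntegrable _ _) fun y hy => ?_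
  rw [gaussianPDFReal_shift, mul_comm]
  gcongr
  · exact gaussianPDFReal_nonneg 0 1 y
  · have : 0 ≤ k * y := mul_nonneg hk (hu.trans hy.1)
    linarith

lemma le_gcdf_shift {u v k : ℝ} (hv : v ≤ 0) (huv : u ≤ v) (hk : 0 ≤ k) :
    Real.exp (-(k ^ 2 / 2)) * (gcdf v - gcdf u) ≤ gcdf (v + k) - gcdf (u + k) := by
  rw [gcdf_sub, gcdf_sub, ← intervalIntegral.integral_comp_add_right,
    ← intervalIntegral.integral_const_mul]
  refine intervalIntegral.integral_mono_on huv
    ((continuous_const.mul continuous_stdGaussianPDF).intervalIntegrable _ _)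
    ((continuous_stdGaussianPDF.comp (continuous_add_const k)).intervalIntegrable _ _)
    fun y hy => ?_
  rw [gaussianPDFReal_shift, mul_comm]
  gcongr
  · exact gaussianPDFReal_nonneg 0 1 y
  · have : k * y ≤ 0 := mul_nonpos_of_nonneg_of_nonpos hk (hy.2.trans hv)
    linarith

lemma gaussianPDFReal_lt {x y : ℝ} (h : x ^ 2 < y ^ 2) :
    gaussianPDFReal 0 1 y < gaussianPDFReal 0 1 x := by
  simp only [gaussianPDFReal, sub_zero, NNReal.coe_one, mul_one]
  gcongr

/-- The mass of the interval `[-c, c + d]` decreases strictly when it is shifted to the right. -/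
lemma strictAntiOn_shift {c d : ℝ} (hc : 0 < c) (hd : 0 ≤ d) :
    StrictAntiOn (fun k => gcdf (c - k) + gcdf (c + d + k)) (Set.Ici 0) := by
  have hder : ∀ k, HasDerivAt (fun k => gcdf (c - k) + gcdf (c + d + k))
      (gaussianPDFReal 0 1 (c - k) * (-1) + gaussianPDFReal 0 1 (c + d + k) * 1) k := by
    intro k
    exact ((hasDerivAt_gcdf (c - k)).comp k ((hasDerivAt_id k).const_sub c)).add
      ((hasDerivAt_gcdf (c + d + k)).comp k ((hasDerivAt_id k).const_add (c + d)))
  refine strictAntiOn_of_deriv_neg (convex_Ici 0)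
    (fun k _ => (hder k).continuousAt.continuousWithinAt) fun k hk => ?_
  rw [interior_Ici] at hk
  have hk : 0 < k := hk
  rw [(hder k).deriv]
  -- The difference of the squares is (2c + d)(d + 2k) > 0.
  have := gaussianPDFReal_lt (x := c - k) (y := c + d + k) 
    (by nlinarith [mul_pos hc hk, mul_nonneg hc.le hd, mul_nonneg hd hk.le])
  linarith

lemma strictMono_gcdf_add_gcdf (d : ℝ) : StrictMono fun c => gcdf c + gcdf (c + d) :=
  strictMono_gcdf.add fun _ _ h => strictMono_gcdf (by linarith)

/-- The E-interval arises from the I-interval by removing [-cI, -cE] on the left and adding [cI +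
dI, cE + dE] on the right, two pieces of equal mass. A right shift by k multiplies the added mass by
at most exp(-k²/2) and the removed mass by at least that factor. -/
lemma shifted_mass_le_of_interval {cE cI dE dI k : ℝ} (hcE : 0 < cE) (hcI : 0 < cI) (hdI : 0 ≤ dI)
    (hd : dI ≤ dE) (hk : 0 ≤ k)
    (heq : gcdf cE + gcdf (cE + dE) = gcdf cI + gcdf (cI + dI)) :
    gcdf (cE - k) + gcdf (cE + dE + k) ≤ gcdf (cI - k) + gcdf (cI + dI + k) := by
  have hc : cE ≤ cI := by
    refine (strictMono_gcdf_add_gcdf dI).le_iff_le.1 ?_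
    have := strictMono_gcdf.monotone (show cE + dI ≤ cE + dE by linarith)
    linarith
  have hcd : cI + dI ≤ cE + dE := by
    refine strictMono_gcdf.le_iff_le.1 ?_
    have := strictMono_gcdf.monotone hc
    linarith
  have h1 := gcdf_shift_le (by linarith : 0 ≤ cI + dI) hcd hk
  have h2 := le_gcdf_shift (by linarith : -cE ≤ 0) (neg_le_neg hc) hk
  have e1 : gcdf (-cE + k) = 1 - gcdf (cE - k) := by rw [← gcdf_neg]; ring_nf
  have e2 : gcdf (-cI + k) = 1 - gcdf (cI - k) := by rw [← gcdf_neg]; ring_nf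
  rw [e1, e2, gcdf_neg, gcdf_neg] at h2
  have e3 : 1 - gcdf cE - (1 - gcdf cI) = gcdf (cE + dE) - gcdf (cI + dI) := by linarith
  rw [e3] at h2
  linarith

lemma shifted_mass_le {cE cI dE dI kE kI : ℝ} (hcE : 0 < cE) (hcI : 0 < cI) (hdI : 0 ≤ dI)
    (hd : dI ≤ dE) (hkI : 0 ≤ kI) (hk : kI ≤ kE)
    (heq : gcdf cE + gcdf (cE + dE) = gcdf cI + gcdf (cI + dI)) :
    gcdf (cE - kE) + gcdf (cE + dE + kE) ≤ gcdf (cI - kI) + gcdf (cI + dI + kI) :=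
  ((strictAntiOn_shift hcE (hdI.trans hd)).antitoneOn hkI (hkI.trans hk) hk).trans
    (shifted_mass_le_of_interval hcE hcI hdI hd hkI heq)

lemma shifted_mass_lt {cE cI dE dI kE kI : ℝ} (hcE : 0 < cE) (hcI : 0 < cI) (hdI : 0 ≤ dI)
    (hd : dI ≤ dE) (hkI : 0 ≤ kI) (hk : kI < kE)
    (heq : gcdf cE + gcdf (cE + dE) = gcdf cI + gcdf (cI + dI)) :
    gcdf (cE - kE) + gcdf (cE + dE + kE) < gcdf (cI - kI) + gcdf (cI + dI + kI) :=
  (strictAntiOn_shift hcE (hdI.trans hd) hkI (hkI.trans hk.le) hk).trans_le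
    (shifted_mass_le_of_interval hcE hcI hdI hd hkI heq)

/-! ### Limiting critical values and concavity. -/

lemma exists_gcdf_eq {α : ℝ} (hα : α ∈ Set.Ioo (0 : ℝ) (1 / 2)) : ∃ q, 0 < q ∧ gcdf q = 1 - α := by
  obtain ⟨M, hM⟩ := ((tendsto_gcdf_atTop.eventually (lt_mem_nhds
    (show 1 - α < 1 by linarith [hα.1]))).and (eventually_ge_atTop 0)).exists
  obtain ⟨q, hq, h⟩ := intermediate_value_Icc hM.2 continuous_gcdf.continuousOn
    (show 1 - α ∈ Set.Icc (gcdf 0) (gcdf M) from ⟨by rw [gcdf_zero]; linarith [hα.2], hM.1.le⟩)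
  refine ⟨q, hq.1.lt_of_ne ?_, h⟩
  rintro rfl
  rw [gcdf_zero] at h
  linarith [hα.2]

/-- The equation says that [-c, c + d] has mass 1 - α. At c = q the sum falls short of 2 - α because
Φ < 1, and for large c it exceeds it. -/
lemma exists_symmetric_critical_value {α q d : ℝ} (hα : 0 < α) (hq : gcdf q = 1 - α) (hd : 0 ≤ d) :
    ∃ c, q < c ∧ gcdf c + gcdf (c + d) = 2 - α := by
  obtain ⟨M, hM⟩ := ((tendsto_gcdf_atTop.eventually (lt_mem_nhds
    (show 1 - α / 2 < 1 by linarith))).and (eventually_ge_atTop q)).exists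
  have hM' := strictMono_gcdf.monotone (show M ≤ M + d by linarith)
  obtain ⟨c, hc, h⟩ := intermediate_value_Icc hM.2
    (f := fun c => gcdf c + gcdf (c + d))
    (continuous_gcdf.add (continuous_gcdf.comp (continuous_add_const d))).continuousOn
    (show 2 - α ∈ Set.Icc (gcdf q + gcdf (q + d)) (gcdf M + gcdf (M + d)) from
      ⟨by linarith [gcdf_lt_one (q + d)], by linarith [hM.1]⟩)
  refine ⟨c, hc.1.lt_of_ne ?_, h⟩
  rintro rfl
  simp only at h
  linarith [gcdf_lt_one (q + d)]

lemma strictConcaveOn_gcdf : StrictConcaveOn ℝ (Set.Ici 0) gcdf := by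
  refine StrictAntiOn.strictConcaveOn_of_deriv (convex_Ici 0) continuous_gcdf.continuousOn ?_
  rw [interior_Ici]
  intro x hx y hy hxy
  rw [(hasDerivAt_gcdf x).deriv, (hasDerivAt_gcdf y).deriv]
  have hx : 0 < x := hx
  exact gaussianPDFReal_lt (by nlinarith)

/-! ### The coverage constraints and their limits. -/

instance : IsProbabilityMeasure stdNormalPair := by
  unfold stdNormalPair
  infer_instance

/-- The coverage probability in the constraints of the minimization problem. -/
noncomputable def constraintProb (a t r : ℝ) : ℝ :=
  stdNormalPair.real {z | -a ≤ z.1 ∧ r * z.1 - √(1 - r ^ 2) * z.2 ≤ t}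

lemma measurableSet_constraint (a t r : ℝ) :
    MeasurableSet {z : ℝ × ℝ | -a ≤ z.1 ∧ r * z.1 - √(1 - r ^ 2) * z.2 ≤ t} :=
  (measurableSet_le measurable_const measurable_fst).inter
    (measurableSet_le ((measurable_fst.const_mul r).sub (measurable_snd.const_mul _))
      measurable_const)

lemma stdNormalPair_map_neg : stdNormalPair.map (fun z => -z) = stdNormalPair := by
  have h : (gaussianReal 0 1).map (fun x => -x) = gaussianReal 0 1 := by
    rw [gaussianReal_map_neg, neg_zero]
  have := Measure.map_prod_map (gaussianReal 0 1) (gaussianReal 0 1) measurable_neg measurable_neg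
  rw [h] at this
  rw [stdNormalPair]
  nth_rewrite 2 [this]
  rfl

/-- The reflection z ↦ -z preserves the law of the pair and brings the second constraint to the
shape of the first. The problem is thereby seen to be symmetric under exchange of the two bounds. -/
lemma mem_ci2Feasible_iff {α δ σl σu ρ : ℝ} {c : ℝ × ℝ} :
    c ∈ ci2Feasible α δ σl σu ρ ↔ 1 - α ≤ constraintProb c.1 (c.2 + δ / σu) ρ ∧
      1 - α ≤ constraintProb c.2 (c.1 + δ / σl) ρ := by
  have h1 : stdNormalPair.real {z | -c.1 ≤ z.1 ∧ ρ * z.1 ≤ c.2 + δ / σu + √(1 - ρ ^ 2) * z.2}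
      = constraintProb c.1 (c.2 + δ / σu) ρ := by
    simp only [constraintProb, sub_le_iff_le_add]
  have h2 : stdNormalPair.real {z | -c.1 - δ / σl + √(1 - ρ ^ 2) * z.2 ≤ ρ * z.1 ∧ z.1 ≤ c.2}
      = constraintProb c.2 (c.1 + δ / σl) ρ := by
    rw [constraintProb, ← stdNormalPair_map_neg,
      map_measureReal_apply measurable_neg (measurableSet_constraint _ _ _), stdNormalPair_map_neg]
    congr 1
    ext z
    simp only [Set.mem_ofPred_eq, Set.mem_preimage, Prod.fst_neg, Prod.snd_neg]
    constructor <;> rintro ⟨h, h'⟩ <;> constructor <;> linarith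
  rw [ci2Feasible, Set.mem_ofPred_eq, h1, h2]

lemma stdNormalPair_real_fst {s : Set ℝ} (hs : MeasurableSet s) :
    stdNormalPair.real {z | z.1 ∈ s} = (gaussianReal 0 1).real s := by
  have h : stdNormalPair.map Prod.fst = gaussianReal 0 1 := by
    rw [stdNormalPair, Measure.map_fst_prod]
    simp
  rw [← h, map_measureReal_apply measurable_fst hs]
  rfl

lemma constraintProb_le (a t r : ℝ) : constraintProb a t r ≤ gcdf a := by
  rw [← stdGaussian_real_Ici, ← stdNormalPair_real_fst measurableSet_Ici]
  exact measureReal_mono fun z hz => hz.1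

lemma ae_fst_ne (x : ℝ) : ∀ᵐ z ∂stdNormalPair, z.1 ≠ x :=
  Measure.quasiMeasurePreserving_fst.ae (p := fun y => y ≠ x) (by
    rw [ae_iff]
    simp)

lemma eventually_le_iff {X : Type*} {l : Filter X} {f g : X → ℝ} {x y : ℝ}
    (hf : Tendsto f l (𝓝 x)) (hg : Tendsto g l (𝓝 y)) (h : x ≠ y) :
    ∀ᶠ i in l, f i ≤ g i ↔ x ≤ y := by
  rcases lt_or_gt_of_ne h with h | h
  · filter_upwards [hf.eventually_lt hg h] with i hi
    exact iff_of_true hi.le h.le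
  · filter_upwards [hg.eventually_lt hf h] with i hi
    exact iff_of_false hi.not_ge h.not_ge

lemma tendsto_constraintProb {ι : Type*} {l : Filter ι} {a t r : ι → ℝ} {a₀ t₀ : ℝ}
    (ha : Tendsto a l (𝓝 a₀)) (ht : Tendsto t l (𝓝 t₀)) (hr : Tendsto r l (𝓝 1)) :
    Tendsto (fun i => constraintProb (a i) (t i) (r i)) l
      (𝓝 ((gaussianReal 0 1).real (Set.Icc (-a₀) t₀))) := by
  -- Dominated convergence needs a countably generated filter, which `l` need not be. The limit is
  -- therefore taken along a neighbourhood filter of the parameters and then composed.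
  have key : Tendsto (fun p : ℝ × ℝ × ℝ => stdNormalPair
      {z | -p.1 ≤ z.1 ∧ p.2.2 * z.1 - √(1 - p.2.2 ^ 2) * z.2 ≤ p.2.1}) (𝓝 (a₀, t₀, 1))
      (𝓝 (stdNormalPair {z | z.1 ∈ Set.Icc (-a₀) t₀})) := by
    refine tendsto_measure_of_ae_tendsto_indicator_of_isFiniteMeasure _
      (measurable_fst measurableSet_Icc) (fun p => measurableSet_constraint _ _ _) ?_
    filter_upwards [ae_fst_ne (-a₀), ae_fst_ne t₀] with z h1 h2
    have c1 : Tendsto (fun p : ℝ × ℝ × ℝ => -p.1) (𝓝 (a₀, t₀, 1)) (𝓝 (-a₀)) :=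
      Continuous.tendsto (f := fun p : ℝ × ℝ × ℝ => -p.1) (by fun_prop) (a₀, t₀, 1)
    have c2 : Tendsto (fun p : ℝ × ℝ × ℝ => p.2.1) (𝓝 (a₀, t₀, 1)) (𝓝 t₀) :=
      Continuous.tendsto (f := fun p : ℝ × ℝ × ℝ => p.2.1) (by fun_prop) (a₀, t₀, 1)
    have c3 : Tendsto (fun p : ℝ × ℝ × ℝ => p.2.2 * z.1 - √(1 - p.2.2 ^ 2) * z.2)
        (𝓝 (a₀, t₀, 1)) (𝓝 z.1) := by
      have : Continuous fun p : ℝ × ℝ × ℝ => p.2.2 * z.1 - √(1 - p.2.2 ^ 2) * z.2 := by fun_prop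
      simpa using this.tendsto (a₀, t₀, 1)
    filter_upwards [eventually_le_iff c1 tendsto_const_nhds h1.symm, eventually_le_iff c3 c2 h2]
      with p e1 e2
    exact and_congr e1 e2
  have h := (ENNReal.tendsto_toReal (measure_ne_top _ _)).comp
    (key.comp (ha.prodMk_nhds (ht.prodMk_nhds hr)))
  rw [← stdNormalPair_real_fst measurableSet_Icc]
  exact h

/-- With t → ∞ the second condition of the constraint becomes void. The bound |r z₁ - √(1 - r²) z₂|
≤ 2|z₁| + |z₂| makes this uniform in r; an estimated correlation may lie outside [-1, 1], hence the
bound 2. -/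
lemma eventually_lt_constraintProb {ι : Type*} {l : Filter ι} {t r : ι → ℝ} {a p : ℝ}
    (hp : p < gcdf a) (ht : Tendsto t l atTop) (hr : ∀ᶠ i in l, |r i| ≤ 2) :
    ∀ᶠ i in l, p < constraintProb a (t i) (r i) := by
  have key : Tendsto (fun t : ℝ => stdNormalPair
      {z | -a ≤ z.1 ∧ 2 * |z.1| + |z.2| ≤ t}) atTop
      (𝓝 (stdNormalPair {z | z.1 ∈ Set.Ici (-a)})) := by
    refine tendsto_measure_of_ae_tendsto_indicator_of_isFiniteMeasure _
      (measurable_fst measurableSet_Ici) (fun t =>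
        (measurableSet_le measurable_const measurable_fst).inter
          (measurableSet_le ((measurable_fst.abs.const_mul 2).add measurable_snd.abs)
            measurable_const)) (Eventually.of_forall fun z => ?_)
    filter_upwards [eventually_ge_atTop (2 * |z.1| + |z.2|)] with t ht
    exact and_iff_left ht
  have h := (ENNReal.tendsto_toReal (measure_ne_top _ _)).comp (key.comp ht)
  have e := stdNormalPair_real_fst (measurableSet_Ici (a := -a))
  rw [stdGaussian_real_Ici, measureReal_def] at e
  rw [e] at h
  filter_upwards [h.eventually (lt_mem_nhds hp), hr] with i hi hri
  refine hi.trans_le (measureReal_mono fun z hz => ⟨hz.1, le_trans ?_ hz.2⟩)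
  have h1 : r i * z.1 ≤ 2 * |z.1| := (le_abs_self _).trans (by rw [abs_mul]; gcongr)
  have h2 : √(1 - r i ^ 2) ≤ 1 := by
    exact Real.sqrt_le_one.2 (by linarith [sq_nonneg (r i)])
  have h3 : -(√(1 - r i ^ 2) * z.2) ≤ 1 * |z.2| :=
    (neg_le_abs _).trans (by rw [abs_mul, abs_of_nonneg (Real.sqrt_nonneg _)]; gcongr)
  linarith

/-! ### Convergence of the minimizers. -/

lemma le_of_isCI2Solution {α δ σl σu ρ q : ℝ} {c : ℝ × ℝ} (hq : gcdf q = 1 - α)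
    (hc : IsCI2Solution α δ σl σu ρ c) : q ≤ c.1 ∧ q ≤ c.2 := by
  obtain ⟨h1, h2⟩ := mem_ci2Feasible_iff.1 hc.1
  rw [← hq] at h1 h2
  exact ⟨strictMono_gcdf.le_iff_le.1 (h1.trans (constraintProb_le _ _ _)),
    strictMono_gcdf.le_iff_le.1 (h2.trans (constraintProb_le _ _ _))⟩

/-- When the estimated length diverges, the critical values converge to the one-sided quantile. -/
lemma tendsto_solution_of_length_atTop {ι : Type*} {l : Filter ι} {δ σl σu ρ : ι → ℝ}
    {c : ι → ℝ × ℝ} {α q sl su : ℝ} (hsl : 0 < sl) (hsu : 0 < su) (hδ : Tendsto δ l atTop)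
    (hσl : Tendsto σl l (𝓝 sl)) (hσu : Tendsto σu l (𝓝 su)) (hρ : ∀ᶠ i in l, |ρ i| ≤ 2)
    (hc : ∀ᶠ i in l, IsCI2Solution α (δ i) (σl i) (σu i) (ρ i) (c i)) (hq : gcdf q = 1 - α) :
    Tendsto c l (𝓝 (q, q)) := by
  -- The pair (q + ε, q + ε) is eventually feasible, so it bounds the minimum from above.
  have hfeas : ∀ ε > 0, ∀ᶠ i in l,
      σl i * (c i).1 + σu i * (c i).2 ≤ σl i * (q + ε) + σu i * (q + ε) := by
    intro ε hε
    have hlt : 1 - α < gcdf (q + ε) := hq ▸ strictMono_gcdf (by linarith)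
    have e1 := eventually_lt_constraintProb hlt
      (tendsto_atTop_add_const_left l (q + ε) (hδ.atTop_mul_pos (inv_pos.2 hsl)
        (hσl.inv₀ hsl.ne'))) hρ
    have e2 := eventually_lt_constraintProb hlt
      (tendsto_atTop_add_const_left l (q + ε) (hδ.atTop_mul_pos (inv_pos.2 hsu)
        (hσu.inv₀ hsu.ne'))) hρ
    filter_upwards [e1, e2, hc] with i h1 h2 hi
    exact hi.2 (mem_ci2Feasible_iff.2 ⟨h2.le, h1.le⟩ : (q + ε, q + ε) ∈ _)
  have hq' : ∀ᶠ i in l, q ≤ (c i).1 ∧ q ≤ (c i).2 := hc.mono fun i hi => le_of_isCI2Solution hq hi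
  -- Both coordinates are at least q, so an upper bound on the weighted sum of the excesses bounds
  -- each excess.
  have hup : ∀ (s : ι → ℝ) (s₀ : ℝ), 0 < s₀ → Tendsto s l (𝓝 s₀) → ∀ x : ι → ℝ,
      (∀ᶠ i in l, q ≤ x i) →
      (∀ ε > 0, ∀ᶠ i in l, s i * (x i - q) ≤ (σl i + σu i) * ε) → Tendsto x l (𝓝 q) := by
    intro s s₀ hs₀ hs x hx hε
    refine tendsto_order.2 ⟨fun b hb => hx.mono fun i hi => hb.trans_le hi, fun b hb => ?_⟩
    have hK : 0 < sl + su := by linarith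
    -- This choice makes the limit of (σl + σu) ε equal to half of s₀ (b - q).
    set ε := s₀ * (b - q) / (2 * (sl + su)) with hεdef
    have hεpos : 0 < ε := by
      have : 0 < b - q := by linarith
      positivity
    have h1 : Tendsto (fun i => (σl i + σu i) * ε - s i * (b - q)) l
        (𝓝 ((sl + su) * ε - s₀ * (b - q))) :=
      ((hσl.add hσu).mul_const ε).sub (hs.mul_const _)
    have h2 : (sl + su) * ε - s₀ * (b - q) < 0 := by
      have : (sl + su) * ε = s₀ * (b - q) / 2 := by
        rw [hεdef]
        field_simp
      have : 0 < s₀ * (b - q) := mul_pos hs₀ (by linarith)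
      linarith
    filter_upwards [hε ε hεpos, h1.eventually (gt_mem_nhds h2), hs.eventually (lt_mem_nhds hs₀)]
      with i hi hi2 hi3
    by_contra! hcon
    have := mul_le_mul_of_nonneg_left (sub_le_sub_right hcon q) hi3.le
    linarith
  have hpl := hσl.eventually (lt_mem_nhds hsl)
  have hpu := hσu.eventually (lt_mem_nhds hsu)
  suffices h : Tendsto (fun i => (c i).1) l (𝓝 q) ∧ Tendsto (fun i => (c i).2) l (𝓝 q) from
    h.1.prodMk_nhds h.2
  constructor
  · refine hup σl sl hsl hσl _ (hq'.mono fun i hi => hi.1) fun ε hε => ?_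
    filter_upwards [hfeas ε hε, hq', hpu] with i h1 h2 h3
    nlinarith [mul_nonneg h3.le (sub_nonneg.2 h2.2)]
  · refine hup σu su hsu hσu _ (hq'.mono fun i hi => hi.2) fun ε hε => ?_
    filter_upwards [hfeas ε hε, hq', hpl] with i h1 h2 h3
    nlinarith [mul_nonneg h3.le (sub_nonneg.2 h2.1)]

/-- The symmetric pair is the only solution of the limiting minimization problem. -/
lemma eq_of_limit_problem {x y c d A : ℝ} (hx : 0 ≤ x) (hy : 0 ≤ y) (hd : 0 ≤ d)
    (hc : gcdf c + gcdf (c + d) = A) (h1 : A ≤ gcdf x + gcdf (y + d))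
    (h2 : A ≤ gcdf y + gcdf (x + d)) (h : x + y ≤ 2 * c) : x = c ∧ y = c := by
  -- The average of the two constraints is compared with the value at the midpoint of x and y.
  -- Concavity makes the midpoint value at least A, strictly if x ≠ y, while `h` makes it at most A.
  have hm : gcdf ((x + y) / 2) + gcdf ((x + y) / 2 + d) ≤ A := by
    rw [← hc]
    exact (strictMono_gcdf_add_gcdf d).monotone (by linarith : (x + y) / 2 ≤ c)
  have hxd : gcdf (x + d) / 2 + gcdf (y + d) / 2 ≤ gcdf ((x + y) / 2 + d) := by
    have := strictConcaveOn_gcdf.concaveOn.2 (x := x + d) (y := y + d)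
      (show 0 ≤ x + d by linarith) (show 0 ≤ y + d by linarith)
      (by norm_num : (0 : ℝ) ≤ 1 / 2) (by norm_num : (0 : ℝ) ≤ 1 / 2) (by norm_num)
    simp only [smul_eq_mul] at this
    have e : 1 / 2 * (x + d) + 1 / 2 * (y + d) = (x + y) / 2 + d := by ring
    rw [e] at this
    linarith
  have hxy : x = y := by
    by_contra hne
    have := strictConcaveOn_gcdf.2 hx hy hne
      (by norm_num : (0 : ℝ) < 1 / 2) (by norm_num : (0 : ℝ) < 1 / 2) (by norm_num)
    simp only [smul_eq_mul] at this
    have e : 1 / 2 * x + 1 / 2 * y = (x + y) / 2 := by ring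
    rw [e] at this
    linarith
  subst hxy
  have : c ≤ x := (strictMono_gcdf_add_gcdf d).le_iff_le.1 (by rw [hc]; exact h1)
  constructor <;> linarith

/-- When the estimated length converges, the critical values converge to the common solution of
the limiting problem. -/
lemma tendsto_solution_of_length_nhds {ι : Type*} {l : Filter ι} {δ σl σu ρ : ι → ℝ}
    {c : ι → ℝ × ℝ} {α q s D c₀ : ℝ} (hs : 0 < s) (hD : 0 ≤ D) (hδ : Tendsto δ l (𝓝 D))
    (hσl : Tendsto σl l (𝓝 s)) (hσu : Tendsto σu l (𝓝 s)) (hρ : Tendsto ρ l (𝓝 1))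
    (hc : ∀ᶠ i in l, IsCI2Solution α (δ i) (σl i) (σu i) (ρ i) (c i)) (hq : gcdf q = 1 - α)
    (hq0 : 0 < q) (hc0 : q < c₀) (hc₀ : gcdf c₀ + gcdf (c₀ + D / s) = 2 - α) :
    Tendsto c l (𝓝 (c₀, c₀)) := by
  have hd : 0 ≤ D / s := by positivity
  have hδl : Tendsto (fun i => δ i / σl i) l (𝓝 (D / s)) := hδ.div hσl hs.ne'
  have hδu : Tendsto (fun i => δ i / σu i) l (𝓝 (D / s)) := hδ.div hσu hs.ne'
  have hfeas : ∀ ε > 0, ∀ᶠ i in l,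
      σl i * (c i).1 + σu i * (c i).2 ≤ σl i * (c₀ + ε) + σu i * (c₀ + ε) := by
    intro ε hε
    have hlt : 1 - α < (gaussianReal 0 1).real (Set.Icc (-(c₀ + ε)) (c₀ + ε + D / s)) := by
      rw [stdGaussian_real_Icc (by linarith), gcdf_neg]
      have := strictMono_gcdf_add_gcdf (D / s) (show c₀ < c₀ + ε by linarith)
      simp only at this
      linarith
    have e1 := (tendsto_constraintProb (tendsto_const_nhds (x := c₀ + ε))
      (hδu.const_add (c₀ + ε)) hρ).eventually (lt_mem_nhds hlt)
    have e2 := (tendsto_constraintProb (tendsto_const_nhds (x := c₀ + ε))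
      (hδl.const_add (c₀ + ε)) hρ).eventually (lt_mem_nhds hlt)
    filter_upwards [e1, e2, hc] with i h1 h2 hi
    exact hi.2 (mem_ci2Feasible_iff.2 ⟨h1.le, h2.le⟩ : (c₀ + ε, c₀ + ε) ∈ _)
  have hq' : ∀ᶠ i in l, q ≤ (c i).1 ∧ q ≤ (c i).2 := hc.mono fun i hi => le_of_isCI2Solution hq hi
  -- Both deviations eventually lie between s/2 and 3s/2, so their sum is at most four times either
  -- one. As the other coordinate is nonnegative, the objective bound with ε = 1 confines each
  -- coordinate to a compact interval.
  have hmem : ∀ᶠ i in l, c i ∈ Set.Icc q (4 * (c₀ + 1)) ×ˢ Set.Icc q (4 * (c₀ + 1)) := by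
    filter_upwards [hfeas 1 one_pos, hq', hσl.eventually (lt_mem_nhds (half_lt_self hs)),
      hσu.eventually (lt_mem_nhds (half_lt_self hs)),
      hσl.eventually (gt_mem_nhds (show s < 3 / 2 * s by linarith)),
      hσu.eventually (gt_mem_nhds (show s < 3 / 2 * s by linarith))] with i h1 h2 h3 h4 h5 h6
    have b1 : (σl i + σu i) * (c₀ + 1) ≤ 4 * (σl i) * (c₀ + 1) := by gcongr <;> linarith
    have b2 : (σl i + σu i) * (c₀ + 1) ≤ 4 * (σu i) * (c₀ + 1) := by gcongr <;> linarith
    have p1 : 0 < σl i := by linarith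
    have p2 : 0 < σu i := by linarith
    refine ⟨⟨h2.1, ?_⟩, h2.2, ?_⟩
    · by_contra! hcon
      have := mul_lt_mul_of_pos_left hcon p1
      have := mul_nonneg p2.le (hq0.le.trans h2.2)
      linarith
    · by_contra! hcon
      have := mul_lt_mul_of_pos_left hcon p2
      have := mul_nonneg p1.le (hq0.le.trans h2.1)
      linarith
  refine (isCompact_Icc.prod isCompact_Icc).tendsto_nhds_of_unique_mapClusterPt hmem
    fun x hx hcl => ?_
  -- Along an ultrafilter the cluster point is a limit, so the constraints and the objective bound
  -- pass to it. It then solves the limiting problem, whose solution is unique.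
  obtain ⟨U, hU, hUx⟩ := mapClusterPt_iff_ultrafilter.1 hcl
  have hU1 : Tendsto (fun i => (c i).1) U (𝓝 x.1) := (continuous_fst.tendsto x).comp hUx
  have hU2 : Tendsto (fun i => (c i).2) U (𝓝 x.2) := (continuous_snd.tendsto x).comp hUx
  have hx1 : q ≤ x.1 := hx.1.1
  have hx2 : q ≤ x.2 := hx.2.1
  have g1 := ge_of_tendsto (tendsto_constraintProb hU1 (hU2.add (hδu.mono_left hU))
    (hρ.mono_left hU)) ((hc.filter_mono hU).mono fun i hi => (mem_ci2Feasible_iff.1 hi.1).1)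
  have g2 := ge_of_tendsto (tendsto_constraintProb hU2 (hU1.add (hδl.mono_left hU))
    (hρ.mono_left hU)) ((hc.filter_mono hU).mono fun i hi => (mem_ci2Feasible_iff.1 hi.1).2)
  rw [stdGaussian_real_Icc (by linarith), gcdf_neg] at g1 g2
  have hsum : x.1 + x.2 ≤ 2 * c₀ := by
    refine le_of_forall_pos_le_add fun ε hε => ?_
    have := le_of_tendsto_of_tendsto
      (((hσl.mono_left hU).mul hU1).add ((hσu.mono_left hU).mul hU2))
      (((hσl.mono_left hU).mul_const (c₀ + ε / 2)).add
        ((hσu.mono_left hU).mul_const (c₀ + ε / 2)))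
      ((hfeas (ε / 2) (by positivity)).filter_mono hU)
    refine le_of_mul_le_mul_left ?_ hs
    linarith
  obtain ⟨r1, r2⟩ := eq_of_limit_problem (by linarith) (by linarith) hd hc₀
    (by linarith) (by linarith) hsum
  exact Prod.ext r1 r2

/-! ### Convergence in probability and in distribution along a sequence of laws. -/

section HighProbability

variable {Ω : Type*} [MeasurableSpace Ω]

/-- The filter of the events in `ℕ × Ω` that hold with probability tending to one. -/
def whp (P : ℕ → ProbabilityMeasure Ω) : Filter (ℕ × Ω) where
  sets := {S | Tendsto (fun k => (P k : Measure Ω) {ω | (k, ω) ∉ S}) atTop (𝓝 0)}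
  univ_sets := by simp
  sets_of_superset {S T} hS hST := tendsto_of_tendsto_of_tendsto_of_le_of_le tendsto_const_nhds hS
    (fun _ => zero_le) fun k => measure_mono fun _ h h' => h (hST h')
  inter_sets {S T} hS hT := by
    have h := Tendsto.add (show Tendsto _ _ _ from hS) (show Tendsto _ _ _ from hT)
    rw [add_zero] at h
    refine tendsto_of_tendsto_of_tendsto_of_le_of_le tendsto_const_nhds h
      (fun _ => zero_le) fun k => (measure_mono fun ω h => ?_).trans (measure_union_le _ _)
    exact not_and_or.1 h

lemma eventually_whp {P : ℕ → ProbabilityMeasure Ω} {p : ℕ × Ω → Prop} :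
    (∀ᶠ x in whp P, p x) ↔
      Tendsto (fun k => (P k : Measure Ω) {ω | ¬ p (k, ω)}) atTop (𝓝 0) := Iff.rfl

lemma tendsto_fst_whp (P : ℕ → ProbabilityMeasure Ω) : Tendsto Prod.fst (whp P) atTop := by
  intro S hS
  refine eventually_whp.2 (tendsto_const_nhds.congr' ?_)
  filter_upwards [hS] with k hk
  symm
  convert measure_empty (μ := (P k : Measure Ω))
  ext ω
  simpa using hk

lemma eventually_whp_of_ae {P : ℕ → ProbabilityMeasure Ω} {p : ℕ × Ω → Prop}
    (h : ∀ᶠ k in atTop, ∀ᵐ ω ∂(P k : Measure Ω), p (k, ω)) : ∀ᶠ x in whp P, p x :=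
  eventually_whp.2 (tendsto_const_nhds.congr' (h.mono fun _ hk => (ae_iff.1 hk).symm))

lemma UniformlyConsistent.tendsto_whp {Ps : Set (ProbabilityMeasure Ω)} {X : ℕ → Ω → ℝ}
    {x : ProbabilityMeasure Ω → ℝ} (h : UniformlyConsistent Ps X x) {N : ℕ → ℕ}
    (hN : Tendsto N atTop atTop) {P : ℕ → ProbabilityMeasure Ω} (hP : ∀ k, P k ∈ Ps) {x₀ : ℝ}
    (hx : Tendsto (fun k => x (P k)) atTop (𝓝 x₀)) :
    Tendsto (fun z : ℕ × Ω => X (N z.1) z.2) (whp P) (𝓝 x₀) := by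
  have h0 : Tendsto (fun z : ℕ × Ω => X (N z.1) z.2 - x (P z.1)) (whp P) (𝓝 0) := by
    rw [Metric.tendsto_nhds]
    intro ε hε
    refine eventually_whp.2 ?_
    rw [← ENNReal.tendsto_toReal_iff (fun _ => measure_ne_top _ _) ENNReal.zero_ne_top,
      ENNReal.toReal_zero, Metric.tendsto_nhds]
    intro η hη
    filter_upwards [hN.eventually (Metric.tendstoUniformlyOn_iff.1 (h ε hε) η hη)] with k hk
    have := hk (P k) (hP k)
    rw [dist_comm] at this
    simpa [Real.dist_eq, measureReal_def] using this
  simpa using h0.add (hx.comp (tendsto_fst_whp P))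

/-- Convergence in distribution of `X k` under `P k` to the centred normal law with standard
deviation `|τ|`. -/
def TendstoGaussian (P : ℕ → ProbabilityMeasure Ω) (X : ℕ → Ω → ℝ) (τ : ℝ) : Prop :=
  TendstoInDistribution X atTop (fun z : ℝ => τ * z) (fun k => (P k : Measure Ω))
    (gaussianReal 0 1)

variable {P : ℕ → ProbabilityMeasure Ω} {X : ℕ → Ω → ℝ} {τ : ℝ}

lemma TendstoGaussian.eventually_measure_lt (h : TendstoGaussian P X τ) {F : Set ℝ}
    (hF : IsClosed F) {b : ENNReal} (hb : (gaussianReal 0 1) {z | τ * z ∈ F} < b) :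
    ∀ᶠ k in atTop, (P k : Measure Ω) {ω | X k ω ∈ F} < b := by
  have := ProbabilityMeasure.limsup_measure_closed_le_of_tendsto h.tendsto hF
  simp only [ProbabilityMeasure.coe_mk] at this
  rw [Measure.map_apply_of_aemeasurable h.aemeasurable_limit hF.measurableSet] at this
  refine (eventually_lt_of_limsup_lt (this.trans_lt hb)).mono fun k hk => ?_
  rwa [Measure.map_apply_of_aemeasurable (h.forall_aemeasurable k) hF.measurableSet] at hk

lemma TendstoGaussian.eventually_lt_measure (h : TendstoGaussian P X τ) {G : Set ℝ}
    (hG : IsOpen G) {b : ENNReal} (hb : b < (gaussianReal 0 1) {z | τ * z ∈ G}) :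
    ∀ᶠ k in atTop, b < (P k : Measure Ω) {ω | X k ω ∈ G} := by
  have := ProbabilityMeasure.le_liminf_measure_open_of_tendsto h.tendsto hG
  simp only [ProbabilityMeasure.coe_mk] at this
  rw [Measure.map_apply_of_aemeasurable h.aemeasurable_limit hG.measurableSet] at this
  refine (eventually_lt_of_lt_liminf (hb.trans_le this)).mono fun k hk => ?_
  rwa [Measure.map_apply_of_aemeasurable (h.forall_aemeasurable k) hG.measurableSet] at hk

/-- Portmanteau bound for events contained in {X ∈ F} up to vanishing probability. The events may be
nonmeasurable, as critical values are chosen arbitrarily per sample; only monotonicity and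
subadditivity of outer measure are used for them. -/
lemma TendstoGaussian.eventually_real_lt (h : TendstoGaussian P X τ) {F : Set ℝ}
    (hF : IsClosed F) {C : ℕ → Set Ω} {b : ℝ} (hb : (gaussianReal 0 1).real {z | τ * z ∈ F} < b)
    (hC : ∀ᶠ x in whp P, x.2 ∈ C x.1 → X x.1 x.2 ∈ F) :
    ∀ᶠ k in atTop, (P k : Measure Ω).real (C k) < b := by
  obtain ⟨b', hb', hb''⟩ := exists_between hb
  have h0 : 0 ≤ b' := measureReal_nonneg.trans hb'.le
  have h1 := h.eventually_measure_lt hF (b := ENNReal.ofReal b') (by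
    rwa [ENNReal.lt_ofReal_iff_toReal_lt (measure_ne_top _ _)])
  have h2 := (eventually_whp.1 hC).eventually
    (gt_mem_nhds (ENNReal.ofReal_pos.2 (sub_pos.2 hb'')))
  filter_upwards [h1, h2] with k hk1 hk2
  rw [ENNReal.lt_ofReal_iff_toReal_lt (measure_ne_top _ _), ← measureReal_def] at hk1 hk2
  have h3 : (P k : Measure Ω).real (C k) ≤ (P k : Measure Ω).real
      ({ω | X k ω ∈ F} ∪ {ω | ¬ (ω ∈ C k → X k ω ∈ F)}) := by
    refine measureReal_mono fun ω hω => ?_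
    by_cases hF : X k ω ∈ F
    · exact Or.inl hF
    · exact Or.inr fun h => hF (h hω)
  have h4 := measureReal_union_le (μ := (P k : Measure Ω)) {ω | X k ω ∈ F}
    {ω | ¬ (ω ∈ C k → X k ω ∈ F)}
  linarith

lemma TendstoGaussian.eventually_lt_real (h : TendstoGaussian P X τ) {G : Set ℝ}
    (hG : IsOpen G) {C : ℕ → Set Ω} {b : ℝ} (hb : b < (gaussianReal 0 1).real {z | τ * z ∈ G})
    (hC : ∀ᶠ x in whp P, X x.1 x.2 ∈ G → x.2 ∈ C x.1) :
    ∀ᶠ k in atTop, b < (P k : Measure Ω).real (C k) := by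
  rcases lt_or_ge b 0 with hb0 | hb0
  · exact Eventually.of_forall fun k => hb0.trans_le measureReal_nonneg
  obtain ⟨b', hb', hb''⟩ := exists_between hb
  have h0 : 0 ≤ b' := hb0.trans hb'.le
  have h1 := h.eventually_lt_measure hG (b := ENNReal.ofReal b') (by
    rwa [ENNReal.ofReal_lt_iff_lt_toReal h0 (measure_ne_top _ _)])
  have h2 := (eventually_whp.1 hC).eventually
    (gt_mem_nhds (ENNReal.ofReal_pos.2 (sub_pos.2 hb')))
  filter_upwards [h1, h2] with k hk1 hk2
  rw [ENNReal.ofReal_lt_iff_lt_toReal h0 (measure_ne_top _ _), ← measureReal_def] at hk1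
  rw [ENNReal.lt_ofReal_iff_toReal_lt (measure_ne_top _ _), ← measureReal_def] at hk2
  have h3 : (P k : Measure Ω).real {ω | X k ω ∈ G} ≤ (P k : Measure Ω).real
      (C k ∪ {ω | ¬ (X k ω ∈ G → ω ∈ C k)}) := by
    refine measureReal_mono fun ω hω => ?_
    by_cases hF : ω ∈ C k
    · exact Or.inl hF
    · exact Or.inr fun h => hF (h hω)
  have h4 := measureReal_union_le (μ := (P k : Measure Ω)) (C k)
    {ω | ¬ (X k ω ∈ G → ω ∈ C k)}
  linarith

/-- A sequence converging in law is tight, so a divergent deterministic drift dominates it. -/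
lemma TendstoGaussian.add_tendsto_atTop (h : TendstoGaussian P X τ) {D : ℕ → ℝ}
    (hD : Tendsto D atTop atTop) :
    Tendsto (fun x : ℕ × Ω => X x.1 x.2 + D x.1) (whp P) atTop := by
  refine tendsto_atTop.2 fun M => eventually_whp.2 (ENNReal.tendsto_nhds_zero.2 fun b hb => ?_)
  have h0 : Tendsto (fun K : ℝ => (gaussianReal 0 1) {z | τ * z ∈ Set.Iic K}) atBot (𝓝 0) := by
    have hm : Measurable fun z : ℝ => τ * z := by fun_prop
    have := Measure.isProbabilityMeasure_map (μ := gaussianReal 0 1) hm.aemeasurable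
    have := ENNReal.tendsto_ofReal (tendsto_cdf_atBot ((gaussianReal 0 1).map fun z : ℝ => τ * z))
    rw [ENNReal.ofReal_zero] at this
    refine this.congr fun K => ?_
    rw [ofReal_cdf, Measure.map_apply hm measurableSet_Iic]
    rfl
  obtain ⟨K, hK⟩ := (h0.eventually (gt_mem_nhds hb)).exists
  filter_upwards [h.eventually_measure_lt isClosed_Iic hK, hD.eventually_ge_atTop (M - K)]
    with k hk hDk
  refine (measure_mono fun ω hω => ?_).trans hk.le
  have : ¬ M ≤ X k ω + D k := hω
  show X k ω ≤ K
  linarith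

lemma TendstoGaussian.tendsto_zero (h : TendstoGaussian P X 0) :
    Tendsto (fun x : ℕ × Ω => X x.1 x.2) (whp P) (𝓝 0) := by
  rw [Metric.tendsto_nhds]
  intro ε hε
  refine eventually_whp.2 (ENNReal.tendsto_nhds_zero.2 fun b hb => ?_)
  have hF : IsClosed {x : ℝ | ε ≤ |x|} := isClosed_le continuous_const continuous_abs
  refine (h.eventually_measure_lt hF (b := b) ?_).mono fun k hk => ?_
  · convert hb
    convert measure_empty (μ := gaussianReal 0 1)
    ext z
    simpa using hε
  · refine le_trans (le_of_eq ?_) hk.le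
    simp

/-- A nondegenerate normal law charges every half-line (-∞, B). This is how the ordering of the
estimators enters. -/
lemma TendstoGaussian.eq_zero_of_bddBelow (h : TendstoGaussian P X τ) (hτ : 0 ≤ τ) {B : ℝ}
    (hB : ∀ᶠ x in whp P, B ≤ X x.1 x.2) : τ = 0 := by
  by_contra hne
  have hpos : 0 < τ := lt_of_le_of_ne hτ (Ne.symm hne)
  have hg : 0 < (gaussianReal 0 1).real {z | τ * z ∈ Set.Iio B} := by
    have hsub : Set.Iic (B / τ - 1) ⊆ {z | τ * z ∈ Set.Iio B} := by
      intro z hz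
      have hz : z ≤ B / τ - 1 := hz
      have hz : z < B / τ := by linarith
      rw [lt_div_iff₀ hpos] at hz
      show τ * z < B
      linarith
    have h1 : 0 < gcdf (B / τ - 1) :=
      lt_of_le_of_lt (measureReal_nonneg (s := Set.Iic (B / τ - 1 - 1)))
        (strictMono_gcdf (sub_one_lt _))
    exact h1.trans_le (measureReal_mono hsub)
  -- The event {X < B} lies in the empty event up to vanishing probability, so the empty event would
  -- have positive probability.
  have := h.eventually_lt_real isOpen_Iio (C := fun _ => ∅) hg (hB.mono fun x hx hx' =>
    absurd hx (not_le.2 hx'))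
  obtain ⟨k, hk⟩ := this.exists
  simp at hk

end HighProbability

/-! ### Linear combinations of a bivariate normal vector. -/

section Projections

lemma posSemidef_covMat {sl su r : ℝ} (hr : r ∈ Set.Icc (-1 : ℝ) 1) :
    (covMat sl su r).PosSemidef := by
  refine Matrix.PosSemidef.of_dotProduct_mulVec_nonneg ?_ fun x => ?_
  · ext i j
    fin_cases i <;> fin_cases j <;> simp [covMat]
  · simp only [covMat, dotProduct, Matrix.mulVec, Fin.sum_univ_two, Pi.star_apply, star_trivial,
      Matrix.of_apply, Matrix.cons_val_zero, Matrix.cons_val_one]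
    have h : 0 ≤ 1 - r ^ 2 := by nlinarith [hr.1, hr.2]
    -- The quadratic form equals (sl x₀ + r su x₁)² + (1 - r²)(su x₁)².
    nlinarith [sq_nonneg (sl * x 0 + r * su * x 1), mul_nonneg h (sq_nonneg (su * x 1))]

/-- The variance of `v * X + w * Y` when `(X, Y)` has covariance matrix `covMat sl su r`. -/
def combVar (v w sl su r : ℝ) : ℝ :=
  v ^ 2 * sl ^ 2 + 2 * r * v * w * sl * su + w ^ 2 * su ^ 2

/-- Linear images of Gaussian vectors are Gaussian. Writing the law as that of a multiple of a
standard normal variable includes zero variance. -/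
lemma map_multivariateGaussian_covMat {sl su r : ℝ} (hr : r ∈ Set.Icc (-1 : ℝ) 1) (v w : ℝ) :
    (multivariateGaussian 0 (covMat sl su r)).map (fun x => v * x 0 + w * x 1)
      = (gaussianReal 0 1).map (fun z => √(combVar v w sl su r) * z) := by
  set μ := multivariateGaussian 0 (covMat sl su r) with hμ
  have hL : (fun x : EuclideanSpace ℝ (Fin 2) => v * x 0 + w * x 1)
      = fun x => innerSL ℝ (!₂[v, w] : EuclideanSpace ℝ (Fin 2)) x := by
    funext x
    simp [PiLp.inner_apply, Fin.sum_univ_two, mul_comm]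
  have hvar : Var[fun x => innerSL ℝ (!₂[v, w] : EuclideanSpace ℝ (Fin 2)) x; μ]
      = combVar v w sl su r := by
    have h := covarianceBilin_self (μ := μ) IsGaussian.memLp_two_id !₂[v, w]
    rw [covarianceBilin_multivariateGaussian (posSemidef_covMat hr)] at h
    refine Eq.trans h.symm ?_
    simp only [covMat, dotProduct, Matrix.mulVec, Fin.sum_univ_two,
      Matrix.of_apply, Matrix.cons_val_zero, Matrix.cons_val_one, combVar]
    ring
  have hmean : ∫ x, innerSL ℝ (!₂[v, w] : EuclideanSpace ℝ (Fin 2)) x ∂μ = 0 := by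
    rw [ContinuousLinearMap.integral_comp_id_comm IsGaussian.integrable_id,
      integral_id_multivariateGaussian, map_zero]
  have hnn : 0 ≤ combVar v w sl su r := by
    rw [← hvar]
    exact variance_nonneg _ _
  rw [hL, IsGaussian.map_eq_gaussianReal, gaussianReal_map_const_mul, hmean, hvar, mul_zero,
    mul_one]
  congr 1
  ext
  simp [Real.sq_sqrt hnn, hnn]

end Projections

/-! ### Limits of probabilities of events with random thresholds. -/

section CoverageLimits

variable {Ω : Type*} [MeasurableSpace Ω] {P : ℕ → ProbabilityMeasure Ω} {X : ℕ → Ω → ℝ} {τ : ℝ}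

lemma stdGaussian_real_scaled_Iic (hτ : 0 < τ) (x : ℝ) :
    (gaussianReal 0 1).real {z | τ * z ∈ Set.Iic x} = gcdf (x / τ) := by
  rw [gcdf]
  congr 1
  ext z
  show τ * z ≤ x ↔ z ≤ x / τ
  rw [le_div_iff₀ hτ, mul_comm]

lemma stdGaussian_real_scaled_Iio (hτ : 0 < τ) (x : ℝ) :
    (gaussianReal 0 1).real {z | τ * z ∈ Set.Iio x} = gcdf (x / τ) := by
  rw [gcdf, ← measureReal_congr (Iio_ae_eq_Iic (a := x / τ))]
  congr 1
  ext z
  show τ * z < x ↔ z < x / τ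
  rw [lt_div_iff₀ hτ, mul_comm]

lemma stdGaussian_real_scaled_Icc (hτ : 0 < τ) {x y : ℝ} (h : x ≤ y) :
    (gaussianReal 0 1).real {z | τ * z ∈ Set.Icc x y} = gcdf (y / τ) - gcdf (x / τ) := by
  rw [← stdGaussian_real_Icc (div_le_div_of_nonneg_right h hτ.le)]
  congr 1
  ext z
  show (x ≤ τ * z ∧ τ * z ≤ y) ↔ (x / τ ≤ z ∧ z ≤ y / τ)
  rw [le_div_iff₀ hτ, div_le_iff₀ hτ, mul_comm]

/-- No order of x and y is needed, since the left side is nonpositive if they cross. This happens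
below when an interval is shrunk by ε at both ends. -/
lemma le_stdGaussian_real_scaled_Ioo (hτ : 0 < τ) (x y : ℝ) :
    gcdf (y / τ) - gcdf (x / τ) ≤ (gaussianReal 0 1).real {z | τ * z ∈ Set.Ioo x y} := by
  rcases le_or_gt x y with h | h
  · rw [← stdGaussian_real_Icc (div_le_div_of_nonneg_right h hτ.le),
      ← measureReal_congr (Ioo_ae_eq_Icc (a := x / τ) (b := y / τ))]
    refine measureReal_mono fun z hz => ?_
    have hz : x / τ < z ∧ z < y / τ := hz
    rw [lt_div_iff₀ hτ, div_lt_iff₀ hτ, mul_comm] at hz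
    exact hz
  · have := strictMono_gcdf.monotone (div_le_div_of_nonneg_right h.le hτ.le)
    exact le_trans (by linarith) measureReal_nonneg

lemma exists_pos_mem_of_mem_nhds {f : ℝ → ℝ} {p : Set ℝ} (hf : Continuous f) (hp : p ∈ 𝓝 (f 0)) :
    ∃ ε > 0, f ε ∈ p := by
  have h : ∀ᶠ ε in 𝓝[>] (0 : ℝ), f ε ∈ p :=
    ((hf.tendsto 0).eventually hp).filter_mono nhdsWithin_le_nhds
  obtain ⟨ε, h1, h2⟩ := (h.and self_mem_nhdsWithin).exists
  exact ⟨ε, h2, h1⟩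

lemma TendstoGaussian.tendsto_coverage_zero (h : TendstoGaussian P X τ) (hτ : 0 < τ)
    {W : ℕ × Ω → ℝ} (hW : Tendsto W (whp P) atBot) {C : ℕ → Set Ω}
    (hC : ∀ᶠ x in whp P, x.2 ∈ C x.1 → X x.1 x.2 ≤ W x) :
    Tendsto (fun k => (P k : Measure Ω).real (C k)) atTop (𝓝 0) := by
  refine tendsto_order.2 ⟨fun b hb => Eventually.of_forall fun k => hb.trans_le measureReal_nonneg,
    fun b hb => ?_⟩
  obtain ⟨M, hM⟩ := ((tendsto_gcdf_atBot.comp (tendsto_id.atBot_div_const hτ)).eventually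
    (gt_mem_nhds hb)).exists
  refine h.eventually_real_lt isClosed_Iic
    (by rw [stdGaussian_real_scaled_Iic hτ]; exact hM) ?_
  filter_upwards [hC, hW.eventually_le_atBot M] with x h1 h2 h3
  exact (h1 h3).trans h2

/-- The random threshold is replaced by hi ± ε up to vanishing probability; continuity of Φ removes
ε. -/
lemma TendstoGaussian.tendsto_coverage_one_sided (h : TendstoGaussian P X τ) (hτ : 0 < τ)
    {W : ℕ × Ω → ℝ} {hi : ℝ} (hW : Tendsto W (whp P) (𝓝 hi)) {C : ℕ → Set Ω}
    (hC : ∀ᶠ x in whp P, x.2 ∈ C x.1 ↔ X x.1 x.2 ≤ W x) :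
    Tendsto (fun k => (P k : Measure Ω).real (C k)) atTop (𝓝 (gcdf (hi / τ))) := by
  have hcont : Continuous fun ε => gcdf ((hi + ε) / τ) := continuous_gcdf.comp (by fun_prop)
  have hcont' : Continuous fun ε => gcdf ((hi - ε) / τ) := continuous_gcdf.comp (by fun_prop)
  refine tendsto_order.2 ⟨fun b hb => ?_, fun b hb => ?_⟩
  · obtain ⟨ε, hε, hb⟩ := exists_pos_mem_of_mem_nhds hcont' (lt_mem_nhds (by simpa using hb))
    refine h.eventually_lt_real isOpen_Iio
      (by rw [stdGaussian_real_scaled_Iio hτ]; exact hb) ?_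
    filter_upwards [hC, hW.eventually (lt_mem_nhds (sub_lt_self hi hε))] with x h1 h2 h3
    exact h1.2 (h3.le.trans h2.le)
  · obtain ⟨ε, hε, hb⟩ := exists_pos_mem_of_mem_nhds hcont (gt_mem_nhds (by simpa using hb))
    refine h.eventually_real_lt isClosed_Iic
      (by rw [stdGaussian_real_scaled_Iic hτ]; exact hb) ?_
    filter_upwards [hC, hW.eventually (gt_mem_nhds (lt_add_of_pos_right hi hε))] with x h1 h2 h3
    exact (h1.1 h3).trans h2.le

lemma TendstoGaussian.tendsto_coverage_two_sided (h : TendstoGaussian P X τ) (hτ : 0 < τ)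
    {V W : ℕ × Ω → ℝ} {lo hi : ℝ} (hlohi : lo ≤ hi) (hV : Tendsto V (whp P) (𝓝 lo))
    (hW : Tendsto W (whp P) (𝓝 hi)) {C : ℕ → Set Ω}
    (hC : ∀ᶠ x in whp P, x.2 ∈ C x.1 ↔ V x ≤ X x.1 x.2 ∧ X x.1 x.2 ≤ W x) :
    Tendsto (fun k => (P k : Measure Ω).real (C k)) atTop
      (𝓝 (gcdf (hi / τ) - gcdf (lo / τ))) := by
  have hcont : Continuous fun ε => gcdf ((hi + ε) / τ) - gcdf ((lo - ε) / τ) :=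
    (continuous_gcdf.comp (by fun_prop)).sub (continuous_gcdf.comp (by fun_prop))
  have hcont' : Continuous fun ε => gcdf ((hi - ε) / τ) - gcdf ((lo + ε) / τ) :=
    (continuous_gcdf.comp (by fun_prop)).sub (continuous_gcdf.comp (by fun_prop))
  refine tendsto_order.2 ⟨fun b hb => ?_, fun b hb => ?_⟩
  · obtain ⟨ε, hε, hb⟩ := exists_pos_mem_of_mem_nhds hcont' (lt_mem_nhds (by simpa using hb))
    refine h.eventually_lt_real (G := Set.Ioo (lo + ε) (hi - ε)) isOpen_Ioo
      (lt_of_lt_of_le hb (le_stdGaussian_real_scaled_Ioo hτ _ _)) ?_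
    filter_upwards [hC, hW.eventually (lt_mem_nhds (sub_lt_self hi hε)),
      hV.eventually (gt_mem_nhds (lt_add_of_pos_right lo hε))] with x h1 h2 h2' h3
    exact h1.2 ⟨h2'.le.trans h3.1.le, h3.2.le.trans h2.le⟩
  · obtain ⟨ε, hε, hb⟩ := exists_pos_mem_of_mem_nhds hcont (gt_mem_nhds (by simpa using hb))
    refine h.eventually_real_lt (F := Set.Icc (lo - ε) (hi + ε)) isClosed_Icc
      (by rw [stdGaussian_real_scaled_Icc hτ (by linarith)]; exact hb) ?_
    filter_upwards [hC, hW.eventually (gt_mem_nhds (lt_add_of_pos_right hi hε)),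
      hV.eventually (lt_mem_nhds (sub_lt_self lo hε))] with x h1 h2 h2' h3
    exact ⟨h2'.le.trans (h1.1 h3).1, (h1.1 h3).2.trans h2.le⟩

end CoverageLimits

/-! ### Coverage along regular sequences. -/

lemma IsCI2Solution.swap {α δ σl σu ρ : ℝ} {c : ℝ × ℝ} (h : IsCI2Solution α δ σl σu ρ c) :
    IsCI2Solution α δ σu σl ρ c.swap := by
  have hmem : ∀ {c : ℝ × ℝ} {σl σu : ℝ},
      c ∈ ci2Feasible α δ σl σu ρ → c.swap ∈ ci2Feasible α δ σu σl ρ := fun h =>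
    mem_ci2Feasible_iff.2 (mem_ci2Feasible_iff.1 h).symm
  refine ⟨hmem h.1, fun c' hc' => ?_⟩
  have : σl * c.1 + σu * c.2 ≤ σl * c'.2 + σu * c'.1 := h.2 (hmem hc')
  show σu * c.2 + σl * c.1 ≤ σu * c'.1 + σl * c'.2
  linarith

section RegularSequences

variable {Ω : Type*} [MeasurableSpace Ω]

/-- A sequence of data distributions along which the centred and scaled bound estimators `X`, `Y`
are jointly asymptotically normal, the estimated standard deviations and correlation converge, and
the critical values solve the minimization problem. The scaled identified set has length `D`. -/
structure RegularSeq (α : ℝ) (P : ℕ → ProbabilityMeasure Ω) (D : ℕ → ℝ)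
    (X Y σl σu ρ : ℕ → Ω → ℝ) (c : ℕ → Ω → ℝ × ℝ) (sl su r : ℝ) : Prop where
  sl_pos : 0 < sl
  su_pos : 0 < su
  r_le : r ≤ 1
  neg_le_r : -1 ≤ r
  gaussian : ∀ v w, TendstoGaussian P (fun k ω => v * X k ω + w * Y k ω) (√(combVar v w sl su r))
  tendsto_σl : Tendsto (fun x : ℕ × Ω => σl x.1 x.2) (whp P) (𝓝 sl)
  tendsto_σu : Tendsto (fun x : ℕ × Ω => σu x.1 x.2) (whp P) (𝓝 su)
  tendsto_ρ : Tendsto (fun x : ℕ × Ω => ρ x.1 x.2) (whp P) (𝓝 r)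
  D_nonneg : ∀ k, 0 ≤ D k
  ordered : ∀ᶠ x in whp P, 0 ≤ Y x.1 x.2 - X x.1 x.2 + D x.1
  solution : ∀ᶠ x in whp P, IsCI2Solution α (Y x.1 x.2 - X x.1 x.2 + D x.1) (σl x.1 x.2)
    (σu x.1 x.2) (ρ x.1 x.2) (c x.1 x.2)

/-- The event that the confidence interval covers a point at scaled distance `κ` below the
identified set. -/
def coverSet (D κ : ℕ → ℝ) (X Y σl σu : ℕ → Ω → ℝ) (c : ℕ → Ω → ℝ × ℝ) (k : ℕ) : Set Ω :=
  {ω | X k ω + κ k ≤ σl k ω * (c k ω).1 ∧ -(σu k ω * (c k ω).2) ≤ Y k ω + κ k + D k}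

variable {α : ℝ} {P : ℕ → ProbabilityMeasure Ω} {D : ℕ → ℝ} {X Y σl σu ρ : ℕ → Ω → ℝ}
  {c : ℕ → Ω → ℝ × ℝ} {sl su r : ℝ}

namespace RegularSeq

/-- Reflection of the parameter space interchanges the two ends of the identified set. -/
lemma mirror (h : RegularSeq α P D X Y σl σu ρ c sl su r) :
    RegularSeq α P D (fun k ω => -Y k ω) (fun k ω => -X k ω) σu σl ρ (fun k ω => (c k ω).swap)
      su sl r where
  sl_pos := h.su_pos
  su_pos := h.sl_pos
  r_le := h.r_le
  neg_le_r := h.neg_le_r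
  gaussian v w := by
    have := h.gaussian (-w) (-v)
    convert this using 1
    · funext k ω
      ring
    · simp only [combVar]
      congr 1
      ring
  tendsto_σl := h.tendsto_σu
  tendsto_σu := h.tendsto_σl
  tendsto_ρ := h.tendsto_ρ
  D_nonneg := h.D_nonneg
  ordered := h.ordered.mono fun x hx => by linarith
  solution := h.solution.mono fun x hx => by
    have e : -X x.1 x.2 - -Y x.1 x.2 + D x.1 = Y x.1 x.2 - X x.1 x.2 + D x.1 := by ring
    rw [e]
    exact hx.swap

lemma gaussian_lower (h : RegularSeq α P D X Y σl σu ρ c sl su r) : TendstoGaussian P X sl := by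
  have := h.gaussian 1 0
  simpa [combVar, Real.sqrt_sq h.sl_pos.le] using this

lemma gaussian_sub (h : RegularSeq α P D X Y σl σu ρ c sl su r) :
    TendstoGaussian P (fun k ω => Y k ω - X k ω) (√(combVar (-1) 1 sl su r)) := by
  have := h.gaussian (-1) 1
  convert this using 1
  funext k ω
  ring

/-- If D stays bounded, `ordered` bounds Y - X from below, so its limiting variance vanishes. That
variance is (sl - su)² + 2(1 - r) sl su, a sum of nonnegative terms. -/
lemma degenerate (h : RegularSeq α P D X Y σl σu ρ c sl su r) {D₀ : ℝ}
    (hD : Tendsto D atTop (𝓝 D₀)) :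
    sl = su ∧ r = 1 ∧ Tendsto (fun x : ℕ × Ω => Y x.1 x.2 - X x.1 x.2) (whp P) (𝓝 0) := by
  have hb : ∀ᶠ x in whp P, -(D₀ + 1) ≤ Y x.1 x.2 - X x.1 x.2 := by
    filter_upwards [h.ordered, (hD.comp (tendsto_fst_whp P)).eventually
      (gt_mem_nhds (lt_add_one D₀))] with x h1 h2
    have h2 : D x.1 < D₀ + 1 := h2
    linarith
  have h0 := h.gaussian_sub.eq_zero_of_bddBelow (Real.sqrt_nonneg _) hb
  have ht := h.gaussian_sub
  rw [h0] at ht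
  have hv : combVar (-1) 1 sl su r ≤ 0 := Real.sqrt_eq_zero'.1 h0
  have hp := mul_pos h.sl_pos h.su_pos
  have e : combVar (-1) 1 sl su r = (sl - su) ^ 2 + 2 * (1 - r) * (sl * su) := by
    simp only [combVar]
    ring
  rw [e] at hv
  have hr : 0 ≤ 1 - r := sub_nonneg.2 h.r_le
  have hpr := mul_nonneg hr hp.le
  refine ⟨?_, ?_, ht.tendsto_zero⟩
  · have : (sl - su) ^ 2 = 0 := le_antisymm (by linarith) (sq_nonneg _)
    exact sub_eq_zero.1 (pow_eq_zero_iff two_ne_zero |>.1 this)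
  · have : (1 - r) * (sl * su) = 0 := le_antisymm (by linarith [sq_nonneg (sl - su)]) hpr
    rcases mul_eq_zero.1 this with h | h
    · linarith
    · exact absurd h hp.ne'

lemma tendsto_critical_of_length_atTop (h : RegularSeq α P D X Y σl σu ρ c sl su r)
    (hD : Tendsto D atTop atTop) {q : ℝ} (hq : gcdf q = 1 - α) :
    Tendsto (fun x : ℕ × Ω => c x.1 x.2) (whp P) (𝓝 (q, q)) := by
  refine tendsto_solution_of_length_atTop h.sl_pos h.su_pos (h.gaussian_sub.add_tendsto_atTop hD)
    h.tendsto_σl h.tendsto_σu ?_ h.solution hq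
  filter_upwards [h.tendsto_ρ.eventually (Icc_mem_nhds
    (show -2 < r by linarith [h.neg_le_r]) (show r < 2 by linarith [h.r_le]))] with x hx
  exact abs_le.2 hx

lemma tendsto_critical_of_length_nhds (h : RegularSeq α P D X Y σl σu ρ c sl su r) {D₀ : ℝ}
    (hD : Tendsto D atTop (𝓝 D₀)) {q c₀ : ℝ} (hq : gcdf q = 1 - α) (hq0 : 0 < q) (hc0 : q < c₀)
    (hc₀ : gcdf c₀ + gcdf (c₀ + D₀ / sl) = 2 - α) :
    Tendsto (fun x : ℕ × Ω => c x.1 x.2) (whp P) (𝓝 (c₀, c₀)) := by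
  obtain ⟨rfl, rfl, h0⟩ := h.degenerate hD
  have hδ := h0.add (hD.comp (tendsto_fst_whp P))
  rw [zero_add] at hδ
  exact tendsto_solution_of_length_nhds h.sl_pos
    (ge_of_tendsto' hD h.D_nonneg) hδ h.tendsto_σl h.tendsto_σu h.tendsto_ρ
    h.solution hq hq0 hc0 hc₀

lemma tendsto_lower_margin (h : RegularSeq α P D X Y σl σu ρ c sl su r) {c₀ : ℝ × ℝ}
    (hc : Tendsto (fun x : ℕ × Ω => c x.1 x.2) (whp P) (𝓝 c₀)) :
    Tendsto (fun x : ℕ × Ω => σl x.1 x.2 * (c x.1 x.2).1) (whp P) (𝓝 (sl * c₀.1)) :=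
  h.tendsto_σl.mul ((continuous_fst.tendsto _).comp hc)

lemma tendsto_upper_margin (h : RegularSeq α P D X Y σl σu ρ c sl su r) {c₀ : ℝ × ℝ}
    (hc : Tendsto (fun x : ℕ × Ω => c x.1 x.2) (whp P) (𝓝 c₀)) :
    Tendsto (fun x : ℕ × Ω => σu x.1 x.2 * (c x.1 x.2).2) (whp P) (𝓝 (su * c₀.2)) :=
  h.tendsto_σu.mul ((continuous_snd.tendsto _).comp hc)

lemma tendsto_coverage_of_distance_atTop (h : RegularSeq α P D X Y σl σu ρ c sl su r)
    {κ : ℕ → ℝ} (hκ : Tendsto κ atTop atTop) {c₀ : ℝ × ℝ}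
    (hc : Tendsto (fun x : ℕ × Ω => c x.1 x.2) (whp P) (𝓝 c₀)) :
    Tendsto (fun k => (P k : Measure Ω).real (coverSet D κ X Y σl σu c k)) atTop (𝓝 0) := by
  refine h.gaussian_lower.tendsto_coverage_zero h.sl_pos
    (W := fun x => σl x.1 x.2 * (c x.1 x.2).1 + -κ x.1)
    ((h.tendsto_lower_margin hc).add_atBot
      (tendsto_neg_atTop_atBot.comp (hκ.comp (tendsto_fst_whp P))))
    (Eventually.of_forall fun x hx => ?_)
  have := hx.1
  linarith

lemma tendsto_coverage_of_length_atTop (h : RegularSeq α P D X Y σl σu ρ c sl su r)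
    (hD : Tendsto D atTop atTop) {κ : ℕ → ℝ} {κ₀ : ℝ} (hκ : Tendsto κ atTop (𝓝 κ₀)) {q : ℝ}
    (hq : gcdf q = 1 - α) :
    Tendsto (fun k => (P k : Measure Ω).real (coverSet D κ X Y σl σu c k)) atTop
      (𝓝 (gcdf (q - κ₀ / sl))) := by
  have hc := h.tendsto_critical_of_length_atTop hD hq
  have hκ' := hκ.comp (tendsto_fst_whp P)
  have key := h.gaussian_lower.tendsto_coverage_one_sided h.sl_pos
    (W := fun x => σl x.1 x.2 * (c x.1 x.2).1 - κ x.1) ((h.tendsto_lower_margin hc).sub hκ')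
    (C := coverSet D κ X Y σl σu c) ?_
  · have e : (sl * q - κ₀) / sl = q - κ₀ / sl := by
      have := h.sl_pos.ne'
      field_simp
    rwa [e] at key
  · have hY : TendstoGaussian P Y (√(combVar 0 1 sl su r)) := by simpa using h.gaussian 0 1
    -- The upper end of the interval moves off to infinity, so only the condition at the lower end
    -- remains.
    have hbig := (hY.add_tendsto_atTop hD).atTop_add (hκ'.add (h.tendsto_upper_margin hc))
    filter_upwards [hbig.eventually_ge_atTop 0] with x hx
    have hx : 0 ≤ Y x.1 x.2 + D x.1 + (κ x.1 + σu x.1 x.2 * (c x.1 x.2).2) := hx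
    constructor
    · intro h'
      have := h'.1
      linarith
    · intro h'
      constructor <;> linarith

/-- Since Y - X → 0 in probability, the condition at the upper end becomes one on X alone, and
coverage is a two-sided event for X. -/
lemma tendsto_coverage_of_length_nhds (h : RegularSeq α P D X Y σl σu ρ c sl su r) {D₀ : ℝ}
    (hD : Tendsto D atTop (𝓝 D₀)) {κ : ℕ → ℝ} {κ₀ : ℝ} (hκ : Tendsto κ atTop (𝓝 κ₀)) {q c₀ : ℝ}
    (hq : gcdf q = 1 - α) (hq0 : 0 < q) (hc0 : q < c₀)
    (hc₀ : gcdf c₀ + gcdf (c₀ + D₀ / sl) = 2 - α) :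
    Tendsto (fun k => (P k : Measure Ω).real (coverSet D κ X Y σl σu c k)) atTop
      (𝓝 (gcdf (c₀ - κ₀ / sl) + gcdf (c₀ + D₀ / sl + κ₀ / sl) - 1)) := by
  have hc := h.tendsto_critical_of_length_nhds hD hq hq0 hc0 hc₀
  have hκ' := hκ.comp (tendsto_fst_whp P)
  have hD' := hD.comp (tendsto_fst_whp P)
  obtain ⟨rfl, -, h0⟩ := h.degenerate hD
  have hD0 : 0 ≤ D₀ := ge_of_tendsto' hD h.D_nonneg
  have hs := h.sl_pos
  have key := h.gaussian_lower.tendsto_coverage_two_sided hs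
    (lo := -(sl * c₀) - κ₀ - D₀ - 0) (hi := sl * c₀ - κ₀)
    (V := fun x => -(σu x.1 x.2 * (c x.1 x.2).2) - κ x.1 - D x.1 - (Y x.1 x.2 - X x.1 x.2))
    (W := fun x => σl x.1 x.2 * (c x.1 x.2).1 - κ x.1)
    (by nlinarith [mul_pos hs (hq0.trans hc0)])
    ((((h.tendsto_upper_margin hc).neg.sub hκ').sub hD').sub h0)
    ((h.tendsto_lower_margin hc).sub hκ')
    (C := coverSet D κ X Y σl σu c) ?_
  · have e1 : (sl * c₀ - κ₀) / sl = c₀ - κ₀ / sl := by field_simp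
    have e2 : (-(sl * c₀) - κ₀ - D₀ - 0) / sl = -(c₀ + D₀ / sl + κ₀ / sl) := by
      field_simp
      ring
    rw [e1, e2, gcdf_neg] at key
    convert key using 2
    ring
  · refine Eventually.of_forall fun x => ?_
    constructor
    · rintro ⟨h1, h2⟩
      constructor <;> linarith
    · rintro ⟨h1, h2⟩
      constructor <;> linarith

end RegularSeq

/-- Along a common sequence with limiting length and distance, the coverage probability of the
more efficient estimator has the smaller limit. -/
lemma RegularSeq.exists_coverage_limits (hα : α ∈ Set.Ioo (0 : ℝ) (1 / 2))
    {XE YE σlE σuE ρE XI YI σlI σuI ρI : ℕ → Ω → ℝ} {cE cI : ℕ → Ω → ℝ × ℝ}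
    {slE suE rE slI suI rI : ℝ}
    (hE : RegularSeq α P D XE YE σlE σuE ρE cE slE suE rE)
    (hI : RegularSeq α P D XI YI σlI σuI ρI cI slI suI rI) (hs : slE ≤ slI)
    (hD : Tendsto D atTop atTop ∨ ∃ D₀, Tendsto D atTop (𝓝 D₀))
    {κ : ℕ → ℝ} (hκ0 : ∀ k, 0 ≤ κ k)
    (hκ : Tendsto κ atTop atTop ∨ ∃ κ₀, Tendsto κ atTop (𝓝 κ₀)) :
    ∃ pE pI,
      Tendsto (fun k => (P k : Measure Ω).real (coverSet D κ XE YE σlE σuE cE k)) atTop (𝓝 pE) ∧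
      Tendsto (fun k => (P k : Measure Ω).real (coverSet D κ XI YI σlI σuI cI k)) atTop (𝓝 pI) ∧
      pE ≤ pI ∧ (slE < slI → (∃ κ₀, 0 < κ₀ ∧ Tendsto κ atTop (𝓝 κ₀)) → pE < pI) := by
  obtain ⟨q, hq0, hq⟩ := exists_gcdf_eq hα
  have hpE := hE.sl_pos
  have hpI := hI.sl_pos
  have hno : Tendsto κ atTop atTop → (∃ κ₀, 0 < κ₀ ∧ Tendsto κ atTop (𝓝 κ₀)) → False :=
    fun h ⟨_, _, h'⟩ => not_tendsto_nhds_of_tendsto_atTop h _ h'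
  rcases hD with hD | ⟨D₀, hD⟩
  · rcases hκ with hκ | ⟨κ₀, hκ⟩
    · exact ⟨0, 0,
        hE.tendsto_coverage_of_distance_atTop hκ (hE.tendsto_critical_of_length_atTop hD hq),
        hI.tendsto_coverage_of_distance_atTop hκ (hI.tendsto_critical_of_length_atTop hD hq),
        le_rfl, fun _ h => (hno hκ h).elim⟩
    · have hκ₀ : 0 ≤ κ₀ := ge_of_tendsto' hκ hκ0
      refine ⟨_, _, hE.tendsto_coverage_of_length_atTop hD hκ hq,
        hI.tendsto_coverage_of_length_atTop hD hκ hq, ?_, ?_⟩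
      · exact strictMono_gcdf.monotone
          (sub_le_sub_left (div_le_div_of_nonneg_left hκ₀ hpE hs) q)
      · rintro hlt ⟨κ₁, hpos, hκ₁⟩
        obtain rfl := tendsto_nhds_unique hκ hκ₁
        exact strictMono_gcdf (sub_lt_sub_left (div_lt_div_of_pos_left hpos hpE hlt) q)
  · have hD₀ : 0 ≤ D₀ := ge_of_tendsto' hD hE.D_nonneg
    obtain ⟨aE, haE, hE'⟩ := exists_symmetric_critical_value hα.1 hq (div_nonneg hD₀ hpE.le)
    obtain ⟨aI, haI, hI'⟩ := exists_symmetric_critical_value hα.1 hq (div_nonneg hD₀ hpI.le)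
    rcases hκ with hκ | ⟨κ₀, hκ⟩
    · exact ⟨0, 0,
        hE.tendsto_coverage_of_distance_atTop hκ
          (hE.tendsto_critical_of_length_nhds hD hq hq0 haE hE'),
        hI.tendsto_coverage_of_distance_atTop hκ
          (hI.tendsto_critical_of_length_nhds hD hq hq0 haI hI'),
        le_rfl, fun _ h => (hno hκ h).elim⟩
    · have hκ₀ : 0 ≤ κ₀ := ge_of_tendsto' hκ hκ0
      refine ⟨_, _, hE.tendsto_coverage_of_length_nhds hD hκ hq hq0 haE hE',
        hI.tendsto_coverage_of_length_nhds hD hκ hq hq0 haI hI', ?_, ?_⟩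
      -- Both d = D₀/s and the shift κ₀/s are at least as large for the smaller standard deviation.
      · exact sub_le_sub_right (shifted_mass_le (hq0.trans haE) (hq0.trans haI)
          (div_nonneg hD₀ hpI.le) (div_le_div_of_nonneg_left hD₀ hpE hs)
          (div_nonneg hκ₀ hpI.le) (div_le_div_of_nonneg_left hκ₀ hpE hs) (hE'.trans hI'.symm)) 1
      · rintro hlt ⟨κ₁, hpos, hκ₁⟩
        obtain rfl := tendsto_nhds_unique hκ hκ₁
        exact sub_lt_sub_right (shifted_mass_lt (hq0.trans haE) (hq0.trans haI)
          (div_nonneg hD₀ hpI.le) (div_le_div_of_nonneg_left hD₀ hpE hs)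
          (div_nonneg hκ₀ hpI.le) (div_lt_div_of_pos_left hpos hpE hlt) (hE'.trans hI'.symm)) 1

end RegularSequences

/-! ### From the ordered bounds setup to regular sequences. -/

section FromSetup

variable {Ω : Type*} [MeasurableSpace Ω] {Ps : Set (ProbabilityMeasure Ω)}
  {θl θu : ProbabilityMeasure Ω → ℝ} {σlo σhi Δ : ℝ} {e : BoundsEstimator Ω}
  {p : AsymptoticParams Ω}

/-- The centred and scaled estimator of the lower bound along a sequence. -/
noncomputable def scaledLower (e : BoundsEstimator Ω) (θl : ProbabilityMeasure Ω → ℝ) (N : ℕ → ℕ)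
    (P : ℕ → ProbabilityMeasure Ω) (k : ℕ) (ω : Ω) : ℝ :=
  √(N k : ℝ) * (e.θl (N k) ω - θl (P k))

/-- The centred and scaled estimator of the upper bound along a sequence. -/
noncomputable def scaledUpper (e : BoundsEstimator Ω) (θu : ProbabilityMeasure Ω → ℝ) (N : ℕ → ℕ)
    (P : ℕ → ProbabilityMeasure Ω) (k : ℕ) (ω : Ω) : ℝ :=
  √(N k : ℝ) * (e.θu (N k) ω - θu (P k))

/-- The scaled length of the identified set along a sequence. -/
noncomputable def scaledLength (θl θu : ProbabilityMeasure Ω → ℝ) (N : ℕ → ℕ)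
    (P : ℕ → ProbabilityMeasure Ω) (k : ℕ) : ℝ :=
  √(N k : ℝ) * (θu (P k) - θl (P k))

/-- The limit law in the setup depends on P. Uniformity makes the error at P k vanish, and the
normal laws themselves converge because their parameters do. -/
lemma OrderedBoundsSetup.tendstoGaussian (hS : OrderedBoundsSetup Ps θl θu σlo σhi Δ e p)
    {N : ℕ → ℕ} (hN : Tendsto N atTop atTop) {P : ℕ → ProbabilityMeasure Ω} (hP : ∀ k, P k ∈ Ps)
    {sl su r : ℝ} (hsl : Tendsto (fun k => p.σl (P k)) atTop (𝓝 sl))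
    (hsu : Tendsto (fun k => p.σu (P k)) atTop (𝓝 su))
    (hr : Tendsto (fun k => p.ρ (P k)) atTop (𝓝 r)) (v w : ℝ) :
    TendstoGaussian P (fun k ω => v * scaledLower e θl N P k ω + w * scaledUpper e θu N P k ω)
      (√(combVar v w sl su r)) := by
  have hm : ∀ k, Measurable fun ω =>
      v * scaledLower e θl N P k ω + w * scaledUpper e θu N P k ω := fun k =>
    ((((e.measurable_θl (N k)).sub_const _).const_mul _).const_mul v).add
      ((((e.measurable_θu (N k)).sub_const _).const_mul _).const_mul w)
  have hlim : Measurable fun z : ℝ => √(combVar v w sl su r) * z := measurable_id.const_mul _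
  refine ⟨fun k => (hm k).aemeasurable, hlim.aemeasurable, ?_⟩
  refine ProbabilityMeasure.tendsto_iff_forall_integral_tendsto.2 fun g => ?_
  change Tendsto (fun k => ∫ x, g x ∂((P k : Measure Ω).map _)) atTop
    (𝓝 (∫ x, g x ∂((gaussianReal 0 1).map _)))
  rw [integral_map hlim.aemeasurable g.continuous.aestronglyMeasurable]
  have hproj : Continuous fun x : EuclideanSpace ℝ (Fin 2) => v * x 0 + w * x 1 := by fun_prop
  have hgauss : Tendsto (fun k => ∫ z, g (√(combVar v w (p.σl (P k)) (p.σu (P k)) (p.ρ (P k))) * z)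
      ∂(gaussianReal 0 1)) atTop
      (𝓝 (∫ z, g (√(combVar v w sl su r) * z) ∂(gaussianReal 0 1))) := by
    have hcv : Tendsto (fun k => √(combVar v w (p.σl (P k)) (p.σu (P k)) (p.ρ (P k)))) atTop
        (𝓝 (√(combVar v w sl su r))) := by
      exact ((((hsl.pow 2).const_mul (v ^ 2)).add
        (((((hr.const_mul 2).mul_const v).mul_const w).mul hsl).mul hsu)).add
          ((hsu.pow 2).const_mul (w ^ 2))).sqrt
    refine tendsto_integral_of_dominated_convergence (fun _ => ‖g‖)
      (fun k => (g.continuous.comp (continuous_const_mul _)).aestronglyMeasurable)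
      (integrable_const _) (fun k => ae_of_all _ fun z => g.norm_coe_le_norm _)
      (ae_of_all _ fun z => ?_)
    exact (g.continuous.tendsto _).comp (hcv.mul_const z)
  have hdiff := hS.asymptoticallyNormal (g.compContinuous ⟨_, hproj⟩)
  have hzero : Tendsto (fun k =>
      (∫ ω, g (v * scaledLower e θl N P k ω + w * scaledUpper e θu N P k ω) ∂(P k : Measure Ω)) -
        ∫ z, g (√(combVar v w (p.σl (P k)) (p.σu (P k)) (p.ρ (P k))) * z) ∂(gaussianReal 0 1))
      atTop (𝓝 0) := by
    rw [Metric.tendsto_nhds]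
    intro ε hε
    filter_upwards [hN.eventually (Metric.tendstoUniformlyOn_iff.1 hdiff ε hε)] with k hk
    have h1 := hk (P k) (hP k)
    have h2 : ∫ x, (g.compContinuous ⟨_, hproj⟩) x
          ∂(multivariateGaussian 0 (covMat (p.σl (P k)) (p.σu (P k)) (p.ρ (P k))))
        = ∫ z, g (√(combVar v w (p.σl (P k)) (p.σu (P k)) (p.ρ (P k))) * z)
          ∂(gaussianReal 0 1) := by
      rw [← integral_map (φ := fun z : ℝ => √(combVar v w (p.σl (P k)) (p.σu (P k)) (p.ρ (P k))) * z)
        (measurable_id.const_mul _).aemeasurable g.continuous.aestronglyMeasurable,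
        ← map_multivariateGaussian_covMat (hS.ρ_mem _ (hP k)),
        integral_map hproj.measurable.aemeasurable g.continuous.aestronglyMeasurable]
      rfl
    rw [h2, dist_comm, Real.dist_eq] at h1
    rw [Real.dist_eq, sub_zero]
    exact h1
  have := hzero.add hgauss
  simp only [sub_add_cancel, zero_add] at this
  refine this.congr fun k => ?_
  rw [integral_map (hm k).aemeasurable g.continuous.aestronglyMeasurable]

lemma OrderedBoundsSetup.regularSeq (hS : OrderedBoundsSetup Ps θl θu σlo σhi Δ e p)
    (hΘ : ∀ P ∈ Ps, θl P ≤ θu P) {α : ℝ} {c : ℕ → Ω → ℝ × ℝ} (hc : IsCI2CriticalValue α e c)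
    {N : ℕ → ℕ} (hN : Tendsto N atTop atTop) {P : ℕ → ProbabilityMeasure Ω} (hP : ∀ k, P k ∈ Ps)
    {sl su r : ℝ} (hsl : Tendsto (fun k => p.σl (P k)) atTop (𝓝 sl))
    (hsu : Tendsto (fun k => p.σu (P k)) atTop (𝓝 su))
    (hr : Tendsto (fun k => p.ρ (P k)) atTop (𝓝 r)) :
    RegularSeq α P (scaledLength θl θu N P) (scaledLower e θl N P) (scaledUpper e θu N P)
      (fun k => e.σl (N k)) (fun k => e.σu (N k)) (fun k => e.ρ (N k)) (fun k => c (N k))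
      sl su r := by
  have hδ : ∀ k ω, scaledUpper e θu N P k ω - scaledLower e θl N P k ω + scaledLength θl θu N P k
      = √(N k : ℝ) * (e.θu (N k) ω - e.θl (N k) ω) := fun k ω => by
    simp only [scaledUpper, scaledLower, scaledLength]
    ring
  have hl := hS.consistent_σl.tendsto_whp hN hP hsl
  have hu := hS.consistent_σu.tendsto_whp hN hP hsu
  have hsl0 : 0 < sl :=
    hS.σlo_pos.trans_le (ge_of_tendsto' hsl fun k => (hS.σl_mem _ (hP k)).1)
  have hsu0 : 0 < su :=
    hS.σlo_pos.trans_le (ge_of_tendsto' hsu fun k => (hS.σu_mem _ (hP k)).1)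
  have hNpos := hN.eventually_gt_atTop 0
  exact
  { sl_pos := hsl0
    su_pos := hsu0
    r_le := le_of_tendsto' hr fun k => (hS.ρ_mem _ (hP k)).2
    neg_le_r := ge_of_tendsto' hr fun k => (hS.ρ_mem _ (hP k)).1
    gaussian := hS.tendstoGaussian hN hP hsl hsu hr
    tendsto_σl := hl
    tendsto_σu := hu
    tendsto_ρ := hS.consistent_ρ.tendsto_whp hN hP hr
    D_nonneg := fun k => mul_nonneg (Real.sqrt_nonneg _) (sub_nonneg.2 (hΘ _ (hP k)))
    ordered := by
      refine eventually_whp_of_ae ?_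
      filter_upwards [hNpos] with k hk
      filter_upwards [hS.ordered _ (hP k) _ hk] with ω hω
      rw [hδ]
      exact mul_nonneg (Real.sqrt_nonneg _) (sub_nonneg.2 hω)
    solution := by
      filter_upwards [hl.eventually (lt_mem_nhds hsl0), hu.eventually (lt_mem_nhds hsu0),
        (tendsto_fst_whp P).eventually hNpos] with x h1 h2 h3
      rw [hδ]
      exact hc _ _ h3 h1 h2 }

lemma mem_ci2_iff_lower {c : ℕ → Ω → ℝ × ℝ} {N : ℕ → ℕ} {P : ℕ → ProbabilityMeasure Ω} {k : ℕ}
    (hk : 0 < N k) (θ : ℕ → ℝ) (ω : Ω) :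
    θ k ∈ ci2 e c (N k) ω ↔ ω ∈ coverSet (scaledLength θl θu N P)
      (fun k => √(N k : ℝ) * (θl (P k) - θ k)) (scaledLower e θl N P) (scaledUpper e θu N P)
      (fun k => e.σl (N k)) (fun k => e.σu (N k)) (fun k => c (N k)) k := by
  have hs : 0 < √(N k : ℝ) := Real.sqrt_pos.2 (Nat.cast_pos.2 hk)
  simp only [ci2, Set.mem_Icc, coverSet, scaledLength, scaledLower, scaledUpper, Set.mem_ofPred_eq]
  refine and_congr ?_ ?_
  · rw [sub_le_comm, le_div_iff₀ hs]
    constructor <;> intro h <;> linarith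
  · rw [← sub_le_iff_le_add', le_div_iff₀ hs]
    constructor <;> intro h <;> linarith

/-- Reflection turns a point above the identified set into one below it, in the form that matches
`RegularSeq.mirror`. -/
lemma mem_ci2_iff_upper {c : ℕ → Ω → ℝ × ℝ} {N : ℕ → ℕ} {P : ℕ → ProbabilityMeasure Ω} {k : ℕ}
    (hk : 0 < N k) (θ : ℕ → ℝ) (ω : Ω) :
    θ k ∈ ci2 e c (N k) ω ↔ ω ∈ coverSet (scaledLength θl θu N P)
      (fun k => √(N k : ℝ) * (θ k - θu (P k))) (fun k ω => -scaledUpper e θu N P k ω)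
      (fun k ω => -scaledLower e θl N P k ω)
      (fun k => e.σu (N k)) (fun k => e.σl (N k)) (fun k ω => (c (N k) ω).swap) k := by
  have hs : 0 < √(N k : ℝ) := Real.sqrt_pos.2 (Nat.cast_pos.2 hk)
  simp only [ci2, Set.mem_Icc, coverSet, scaledLength, scaledLower, scaledUpper, Set.mem_ofPred_eq,
    Prod.fst_swap, Prod.snd_swap]
  rw [and_comm]
  refine and_congr ?_ ?_
  · rw [← sub_le_iff_le_add', le_div_iff₀ hs]
    constructor <;> intro h <;> linarith
  · rw [sub_le_comm, le_div_iff₀ hs]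
    constructor <;> intro h <;> linarith

end FromSetup

/-! ### Passage to subsequences. -/

section Subsequences

lemma tendsto_atTop_or_nhds_of_ereal {u : ℕ → ℝ} (hu : ∀ k, 0 ≤ u k) {a : EReal}
    (h : Tendsto (fun k => (u k : EReal)) atTop (𝓝 a)) :
    Tendsto u atTop atTop ∨ ∃ x, Tendsto u atTop (𝓝 x) := by
  induction a with
  | bot =>
    have : (0 : EReal) ≤ ⊥ := ge_of_tendsto' h fun k => EReal.coe_nonneg.2 (hu k)
    simp at this
  | top => exact Or.inl (EReal.tendsto_coe_nhds_top_iff.1 h)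
  | coe x => exact Or.inr ⟨x, EReal.tendsto_coe.1 h⟩

lemma liminf_le_of_tendsto_subseq {u : ℕ → ℝ} {B p : ℝ} (hB : ∀ n, |u n| ≤ B) {φ : ℕ → ℕ}
    (hφ : Tendsto φ atTop atTop) (h : Tendsto (fun k => u (φ k)) atTop (𝓝 p)) :
    liminf u atTop ≤ p := by
  by_contra! hlt
  obtain ⟨b, hb1, hb2⟩ := exists_between hlt
  have hev : ∀ᶠ n in atTop, b < u n := eventually_lt_of_lt_liminf hb2
    (isBoundedUnder_of ⟨-B, fun n => (abs_le.1 (hB n)).1⟩)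
  exact absurd (ge_of_tendsto h ((hφ.eventually hev).mono fun k hk => hk.le)) (not_le.2 hb1)

variable {Ω : Type*} [MeasurableSpace Ω] {Ps : Set (ProbabilityMeasure Ω)}
  {θl θu : ProbabilityMeasure Ω → ℝ} {σlo σhi Δ : ℝ} {eE eI : BoundsEstimator Ω}
  {pE pI : AsymptoticParams Ω} {α : ℝ} {cE cI : ℕ → Ω → ℝ × ℝ}

/-- Along a subsequence of any sequence of data distributions, both estimators are regular, and the
scaled length and distance have limits. -/
lemma exists_regular_subseq (hΘ : ∀ P ∈ Ps, θl P ≤ θu P)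
    (hE : OrderedBoundsSetup Ps θl θu σlo σhi Δ eE pE)
    (hI : OrderedBoundsSetup Ps θl θu σlo σhi Δ eI pI)
    (P : ℕ → ProbabilityMeasure Ω) (hP : ∀ k, P k ∈ Ps) (N : ℕ → ℕ) {κ : ℕ → ℝ}
    (hκ : ∀ k, 0 ≤ κ k) :
    ∃ ψ : ℕ → ℕ, StrictMono ψ ∧ ∃ slE suE rE slI suI rI : ℝ,
      Tendsto (fun k => pE.σl (P (ψ k))) atTop (𝓝 slE) ∧
      Tendsto (fun k => pE.σu (P (ψ k))) atTop (𝓝 suE) ∧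
      Tendsto (fun k => pE.ρ (P (ψ k))) atTop (𝓝 rE) ∧
      Tendsto (fun k => pI.σl (P (ψ k))) atTop (𝓝 slI) ∧
      Tendsto (fun k => pI.σu (P (ψ k))) atTop (𝓝 suI) ∧
      Tendsto (fun k => pI.ρ (P (ψ k))) atTop (𝓝 rI) ∧
      (Tendsto (scaledLength θl θu (fun k => N (ψ k)) (fun k => P (ψ k))) atTop atTop ∨
        ∃ D₀, Tendsto (scaledLength θl θu (fun k => N (ψ k)) (fun k => P (ψ k))) atTop (𝓝 D₀)) ∧
      (Tendsto (fun k => κ (ψ k)) atTop atTop ∨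
        ∃ κ₀, Tendsto (fun k => κ (ψ k)) atTop (𝓝 κ₀)) := by
  -- Scaled length and distance may be unbounded; as elements of the compact space `EReal` they
  -- still have convergent subsequences.
  have hcpt : IsCompact ((Set.Icc σlo σhi ×ˢ Set.Icc σlo σhi ×ˢ Set.Icc (-1) 1) ×ˢ
      (Set.Icc σlo σhi ×ˢ Set.Icc σlo σhi ×ˢ Set.Icc (-1) 1) ×ˢ
      (Set.univ : Set (EReal × EReal)) : Set ((ℝ × ℝ × ℝ) × (ℝ × ℝ × ℝ) × EReal × EReal)) :=
    (isCompact_Icc.prod (isCompact_Icc.prod isCompact_Icc)).prod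
      ((isCompact_Icc.prod (isCompact_Icc.prod isCompact_Icc)).prod isCompact_univ)
  obtain ⟨a, -, ψ, hψ, hlim⟩ := hcpt.tendsto_subseq
    (x := fun k => ((pE.σl (P k), pE.σu (P k), pE.ρ (P k)), (pI.σl (P k), pI.σu (P k), pI.ρ (P k)),
      ((scaledLength θl θu N P k : ℝ) : EReal), ((κ k : ℝ) : EReal)))
    (fun k => ⟨⟨hE.σl_mem _ (hP k), hE.σu_mem _ (hP k), hE.ρ_mem _ (hP k)⟩,
      ⟨hI.σl_mem _ (hP k), hI.σu_mem _ (hP k), hI.ρ_mem _ (hP k)⟩, trivial⟩)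
  have hproj : ∀ {Z : Type} [TopologicalSpace Z]
      (f : (ℝ × ℝ × ℝ) × (ℝ × ℝ × ℝ) × EReal × EReal → Z), Continuous f →
      Tendsto (fun k => f ((pE.σl (P (ψ k)), pE.σu (P (ψ k)), pE.ρ (P (ψ k))),
        (pI.σl (P (ψ k)), pI.σu (P (ψ k)), pI.ρ (P (ψ k))),
        ((scaledLength θl θu N P (ψ k) : ℝ) : EReal), ((κ (ψ k) : ℝ) : EReal)))
        atTop (𝓝 (f a)) := fun f hf => (hf.tendsto a).comp hlim
  refine ⟨ψ, hψ, _, _, _, _, _, _, hproj (fun t => t.1.1) (by fun_prop),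
    hproj (fun t => t.1.2.1) (by fun_prop), hproj (fun t => t.1.2.2) (by fun_prop),
    hproj (fun t => t.2.1.1) (by fun_prop), hproj (fun t => t.2.1.2.1) (by fun_prop),
    hproj (fun t => t.2.1.2.2) (by fun_prop), ?_, ?_⟩
  · exact tendsto_atTop_or_nhds_of_ereal
      (fun k => mul_nonneg (Real.sqrt_nonneg _) (sub_nonneg.2 (hΘ _ (hP _))))
      (hproj (fun t => t.2.2.1) (by fun_prop))
  · exact tendsto_atTop_or_nhds_of_ereal (fun k => hκ _) (hproj (fun t => t.2.2.2) (by fun_prop))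

lemma abs_ci2Coverage_sub_le (N : ℕ) (P : ProbabilityMeasure Ω) (θ : ℝ) :
    |ci2Coverage eE cE N P θ - ci2Coverage eI cI N P θ| ≤ 1 := by
  have h1 : ci2Coverage eE cE N P θ ≤ 1 := measureReal_le_one
  have h2 : ci2Coverage eI cI N P θ ≤ 1 := measureReal_le_one
  have h3 : 0 ≤ ci2Coverage eE cE N P θ := measureReal_nonneg
  have h4 : 0 ≤ ci2Coverage eI cI N P θ := measureReal_nonneg
  exact abs_le.2 ⟨by linarith, by linarith⟩

/-- Comparison of the coverage probabilities of points that lie below the identified set infinitely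
often. -/
lemma liminf_coverage_sub_of_frequently_lt (hα : α ∈ Set.Ioo (0 : ℝ) (1 / 2))
    (hΘ : ∀ P ∈ Ps, θl P ≤ θu P)
    (hE : OrderedBoundsSetup Ps θl θu σlo σhi Δ eE pE)
    (hI : OrderedBoundsSetup Ps θl θu σlo σhi Δ eI pI)
    (hEff : ∀ P ∈ Ps, pE.σl P ≤ pI.σl P)
    (hcE : IsCI2CriticalValue α eE cE) (hcI : IsCI2CriticalValue α eI cI)
    {P : ℕ → ProbabilityMeasure Ω} {θ : ℕ → ℝ} (hP : ∀ N, P N ∈ Ps)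
    (hθ : ∃ᶠ N in atTop, θ N < θl (P N)) :
    liminf (fun N => ci2Coverage eE cE N (P N) (θ N) - ci2Coverage eI cI N (P N) (θ N))
      atTop ≤ 0 ∧
    ∀ sE sI Ψ : ℝ, sE < sI → 0 < Ψ → Tendsto (fun N => pE.σl (P N)) atTop (𝓝 sE) →
      Tendsto (fun N => pI.σl (P N)) atTop (𝓝 sI) →
      Tendsto (fun N : ℕ => √(N : ℝ) * (θl (P N) - θ N)) atTop (𝓝 Ψ) →
      liminf (fun N => ci2Coverage eE cE N (P N) (θ N) - ci2Coverage eI cI N (P N) (θ N))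
        atTop < 0 := by
  obtain ⟨φ, hφ, hφθ⟩ := extraction_of_frequently_atTop hθ
  have hκ : ∀ k, 0 ≤ √(φ k : ℝ) * (θl (P (φ k)) - θ (φ k)) := fun k =>
    mul_nonneg (Real.sqrt_nonneg _) (sub_nonneg.2 (hφθ k).le)
  obtain ⟨ψ, hψ, slE, suE, rE, slI, suI, rI, h1, h2, h3, h4, h5, h6, hD, hκlim⟩ :=
    exists_regular_subseq hΘ hE hI (fun k => P (φ k)) (fun k => hP _) φ hκ
  have hN : Tendsto (fun k => φ (ψ k)) atTop atTop := hφ.tendsto_atTop.comp hψ.tendsto_atTop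
  have regE := hE.regularSeq hΘ hcE hN (fun k => hP _) h1 h2 h3
  have regI := hI.regularSeq hΘ hcI hN (fun k => hP _) h4 h5 h6
  obtain ⟨qE, qI, tE, tI, hle, hlt⟩ := RegularSeq.exists_coverage_limits hα regE regI
    (le_of_tendsto_of_tendsto' h1 h4 fun k => hEff _ (hP _)) hD (fun k => hκ (ψ k)) hκlim
  have hsub : Tendsto (fun k => ci2Coverage eE cE (φ (ψ k)) (P (φ (ψ k))) (θ (φ (ψ k)))
      - ci2Coverage eI cI (φ (ψ k)) (P (φ (ψ k))) (θ (φ (ψ k)))) atTop (𝓝 (qE - qI)) := by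
    refine (tE.sub tI).congr' ?_
    filter_upwards [hN.eventually_gt_atTop 0] with k hk
    congr 2
    · ext ω
      exact (mem_ci2_iff_lower (N := fun k => φ (ψ k)) hk (fun k => θ (φ (ψ k))) ω).symm
    · ext ω
      exact (mem_ci2_iff_lower (N := fun k => φ (ψ k)) hk (fun k => θ (φ (ψ k))) ω).symm
  have hlim := liminf_le_of_tendsto_subseq
    (u := fun N => ci2Coverage eE cE N (P N) (θ N) - ci2Coverage eI cI N (P N) (θ N))
    (fun N => abs_ci2Coverage_sub_le _ _ _) hN hsub
  -- For strictness, the assumed limits along the full sequence are identified with those along the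
  -- subsequence.
  refine ⟨hlim.trans (sub_nonpos.2 hle), fun sE sI Ψ hs hΨ tsE tsI tΨ => hlim.trans_lt
    (sub_neg.2 (hlt ?_ ⟨Ψ, hΨ, tΨ.comp hN⟩))⟩
  rwa [tendsto_nhds_unique h1 (tsE.comp hN), tendsto_nhds_unique h4 (tsI.comp hN)]

/-- Comparison of the coverage probabilities of points that lie above the identified set infinitely
often. -/
lemma liminf_coverage_sub_of_frequently_gt (hα : α ∈ Set.Ioo (0 : ℝ) (1 / 2))
    (hΘ : ∀ P ∈ Ps, θl P ≤ θu P)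
    (hE : OrderedBoundsSetup Ps θl θu σlo σhi Δ eE pE)
    (hI : OrderedBoundsSetup Ps θl θu σlo σhi Δ eI pI)
    (hEff : ∀ P ∈ Ps, pE.σu P ≤ pI.σu P)
    (hcE : IsCI2CriticalValue α eE cE) (hcI : IsCI2CriticalValue α eI cI)
    {P : ℕ → ProbabilityMeasure Ω} {θ : ℕ → ℝ} (hP : ∀ N, P N ∈ Ps)
    (hθ : ∃ᶠ N in atTop, θu (P N) < θ N) :
    liminf (fun N => ci2Coverage eE cE N (P N) (θ N) - ci2Coverage eI cI N (P N) (θ N))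
      atTop ≤ 0 ∧
    ∀ sE sI Ψ : ℝ, sE < sI → 0 < Ψ → Tendsto (fun N => pE.σu (P N)) atTop (𝓝 sE) →
      Tendsto (fun N => pI.σu (P N)) atTop (𝓝 sI) →
      Tendsto (fun N : ℕ => √(N : ℝ) * (θ N - θu (P N))) atTop (𝓝 Ψ) →
      liminf (fun N => ci2Coverage eE cE N (P N) (θ N) - ci2Coverage eI cI N (P N) (θ N))
        atTop < 0 := by
  obtain ⟨φ, hφ, hφθ⟩ := extraction_of_frequently_atTop hθ
  have hκ : ∀ k, 0 ≤ √(φ k : ℝ) * (θ (φ k) - θu (P (φ k))) := fun k =>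
    mul_nonneg (Real.sqrt_nonneg _) (sub_nonneg.2 (hφθ k).le)
  obtain ⟨ψ, hψ, slE, suE, rE, slI, suI, rI, h1, h2, h3, h4, h5, h6, hD, hκlim⟩ :=
    exists_regular_subseq hΘ hE hI (fun k => P (φ k)) (fun k => hP _) φ hκ
  have hN : Tendsto (fun k => φ (ψ k)) atTop atTop := hφ.tendsto_atTop.comp hψ.tendsto_atTop
  have regE := hE.regularSeq hΘ hcE hN (fun k => hP _) h1 h2 h3
  have regI := hI.regularSeq hΘ hcI hN (fun k => hP _) h4 h5 h6
  obtain ⟨qE, qI, tE, tI, hle, hlt⟩ := RegularSeq.exists_coverage_limits hα regE.mirror regI.mirror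
    (le_of_tendsto_of_tendsto' h2 h5 fun k => hEff _ (hP _)) hD (fun k => hκ (ψ k)) hκlim
  have hsub : Tendsto (fun k => ci2Coverage eE cE (φ (ψ k)) (P (φ (ψ k))) (θ (φ (ψ k)))
      - ci2Coverage eI cI (φ (ψ k)) (P (φ (ψ k))) (θ (φ (ψ k)))) atTop (𝓝 (qE - qI)) := by
    refine (tE.sub tI).congr' ?_
    filter_upwards [hN.eventually_gt_atTop 0] with k hk
    congr 2
    · ext ω
      exact (mem_ci2_iff_upper (N := fun k => φ (ψ k)) hk (fun k => θ (φ (ψ k))) ω).symm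
    · ext ω
      exact (mem_ci2_iff_upper (N := fun k => φ (ψ k)) hk (fun k => θ (φ (ψ k))) ω).symm
  have hlim := liminf_le_of_tendsto_subseq
    (u := fun N => ci2Coverage eE cE N (P N) (θ N) - ci2Coverage eI cI N (P N) (θ N))
    (fun N => abs_ci2Coverage_sub_le _ _ _) hN hsub
  refine ⟨hlim.trans (sub_nonpos.2 hle), fun sE sI Ψ hs hΨ tsE tsI tΨ => hlim.trans_lt
    (sub_neg.2 (hlt ?_ ⟨Ψ, hΨ, tΨ.comp hN⟩))⟩
  rwa [tendsto_nhds_unique h2 (tsE.comp hN), tendsto_nhds_unique h5 (tsI.comp hN)]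

end Subsequences

/-! ### The comparison theorem. -/

theorem theorem2 {Ω : Type*} [MeasurableSpace Ω]
    (α : ℝ) (hα : α ∈ Set.Ioo (0 : ℝ) (1 / 2))
    (Ps : Set (ProbabilityMeasure Ω)) (θl θu : ProbabilityMeasure Ω → ℝ)
    (hΘ : ∀ P ∈ Ps, θl P ≤ θu P) (σlo σhi Δ : ℝ)
    (eE eI : BoundsEstimator Ω) (pE pI : AsymptoticParams Ω)
    (hE : OrderedBoundsSetup Ps θl θu σlo σhi Δ eE pE)
    (hI : OrderedBoundsSetup Ps θl θu σlo σhi Δ eI pI)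
    (hEff : ∀ P ∈ Ps, pE.σl P ≤ pI.σl P ∧ pE.σu P ≤ pI.σu P)
    (cE cI : ℕ → Ω → ℝ × ℝ)
    (hcE : IsCI2CriticalValue α eE cE) (hcI : IsCI2CriticalValue α eI cI) :
    -- weak inequality along every sequence of alternatives
    (∀ (P : ℕ → ProbabilityMeasure Ω) (θ : ℕ → ℝ),
      (∀ N, P N ∈ Ps ∧ θ N ∉ Set.Icc (θl (P N)) (θu (P N))) →
      liminf (fun N => ci2Coverage eE cE N (P N) (θ N) - ci2Coverage eI cI N (P N) (θ N))
        atTop ≤ 0) ∧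
    -- strict inequality along all local alternatives at an end with a limiting efficiency gap
    (∀ (P : ℕ → ProbabilityMeasure Ω) (θ : ℕ → ℝ) (sE sI Ψ : ℝ),
      (∀ N, P N ∈ Ps ∧ θ N ∉ Set.Icc (θl (P N)) (θu (P N))) →
      sE < sI → 0 < Ψ →
      ((Tendsto (fun N => pE.σl (P N)) atTop (𝓝 sE) ∧
          Tendsto (fun N => pI.σl (P N)) atTop (𝓝 sI) ∧
          Tendsto (fun N : ℕ => √(N : ℝ) * (θl (P N) - θ N)) atTop (𝓝 Ψ)) ∨
        (Tendsto (fun N => pE.σu (P N)) atTop (𝓝 sE) ∧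
          Tendsto (fun N => pI.σu (P N)) atTop (𝓝 sI) ∧
          Tendsto (fun N : ℕ => √(N : ℝ) * (θ N - θu (P N))) atTop (𝓝 Ψ))) →
      liminf (fun N => ci2Coverage eE cE N (P N) (θ N) - ci2Coverage eI cI N (P N) (θ N))
        atTop < 0) ∧
    -- sequences with strict inequality exist as soon as the efficiency gap is not identically zero
    ((∃ P ∈ Ps, pE.σl P < pI.σl P ∨ pE.σu P < pI.σu P) →
      ∃ (P : ℕ → ProbabilityMeasure Ω) (θ : ℕ → ℝ),
        (∀ N, P N ∈ Ps ∧ θ N ∉ Set.Icc (θl (P N)) (θu (P N))) ∧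
        liminf (fun N => ci2Coverage eE cE N (P N) (θ N) - ci2Coverage eI cI N (P N) (θ N))
          atTop < 0) := by
  -- A positive limit of the scaled distance fixes the side on which the points lie.
  have hlocal : ∀ {Ψ : ℝ} {x y : ℕ → ℝ}, 0 < Ψ →
      Tendsto (fun N : ℕ => √(N : ℝ) * (x N - y N)) atTop (𝓝 Ψ) → ∃ᶠ N in atTop, y N < x N := by
    intro Ψ x y hΨ h
    refine (h.eventually (lt_mem_nhds hΨ)).frequently.mono fun N hN => ?_
    exact sub_pos.1 (pos_of_mul_pos_right hN (Real.sqrt_nonneg _))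
  have strict : ∀ (P : ℕ → ProbabilityMeasure Ω) (θ : ℕ → ℝ) (sE sI Ψ : ℝ),
      (∀ N, P N ∈ Ps ∧ θ N ∉ Set.Icc (θl (P N)) (θu (P N))) →
      sE < sI → 0 < Ψ →
      ((Tendsto (fun N => pE.σl (P N)) atTop (𝓝 sE) ∧
          Tendsto (fun N => pI.σl (P N)) atTop (𝓝 sI) ∧
          Tendsto (fun N : ℕ => √(N : ℝ) * (θl (P N) - θ N)) atTop (𝓝 Ψ)) ∨
        (Tendsto (fun N => pE.σu (P N)) atTop (𝓝 sE) ∧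
          Tendsto (fun N => pI.σu (P N)) atTop (𝓝 sI) ∧
          Tendsto (fun N : ℕ => √(N : ℝ) * (θ N - θu (P N))) atTop (𝓝 Ψ))) →
      liminf (fun N => ci2Coverage eE cE N (P N) (θ N) - ci2Coverage eI cI N (P N) (θ N))
        atTop < 0 := by
    rintro P θ sE sI Ψ hPθ hs hΨ (⟨h1, h2, h3⟩ | ⟨h1, h2, h3⟩)
    · exact (liminf_coverage_sub_of_frequently_lt hα hΘ hE hI (fun P hP => (hEff P hP).1) hcE hcI
        (fun N => (hPθ N).1) (hlocal hΨ h3)).2 sE sI Ψ hs hΨ h1 h2 h3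
    · exact (liminf_coverage_sub_of_frequently_gt hα hΘ hE hI (fun P hP => (hEff P hP).2) hcE hcI
        (fun N => (hPθ N).1) (hlocal hΨ h3)).2 sE sI Ψ hs hΨ h1 h2 h3
  -- Local alternatives for the existence claim, with a constant data distribution. The shift N + 1
  -- keeps the distance positive at N = 0, where 1/√0 would be 0.
  have hscale : Tendsto (fun N : ℕ => √(N : ℝ) * (1 / √((N : ℝ) + 1))) atTop (𝓝 1) := by
    have h := (Real.continuous_sqrt.tendsto 1).comp (tendsto_natCast_div_add_atTop (1 : ℝ))
    rw [Real.sqrt_one] at h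
    refine h.congr fun N => ?_
    simp only [Function.comp_apply]
    rw [Real.sqrt_div (Nat.cast_nonneg N), mul_one_div]
  refine ⟨fun P θ hPθ => ?_, strict, ?_⟩
  · have hout : ∃ᶠ N in atTop, θ N < θl (P N) ∨ θu (P N) < θ N := by
      refine (Eventually.of_forall fun N => ?_).frequently
      by_contra! hcon
      exact (hPθ N).2 hcon
    rcases frequently_or_distrib.1 hout with h | h
    · exact (liminf_coverage_sub_of_frequently_lt hα hΘ hE hI (fun P hP => (hEff P hP).1) hcE hcI
        (fun N => (hPθ N).1) h).1
    · exact (liminf_coverage_sub_of_frequently_gt hα hΘ hE hI (fun P hP => (hEff P hP).2) hcE hcI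
        (fun N => (hPθ N).1) h).1
  · rintro ⟨P, hP, h | h⟩
    · refine ⟨fun _ => P, fun N => θl P - 1 / √((N : ℝ) + 1), fun N => ⟨hP, fun hmem => ?_⟩,
        strict _ _ _ _ 1 (fun N => ⟨hP, fun hmem => ?_⟩) h one_pos
          (Or.inl ⟨tendsto_const_nhds, tendsto_const_nhds, by simpa using hscale⟩)⟩ <;>
      · have : 0 < 1 / √((N : ℝ) + 1) := by positivity
        linarith [hmem.1]
    · refine ⟨fun _ => P, fun N => θu P + 1 / √((N : ℝ) + 1), fun N => ⟨hP, fun hmem => ?_⟩,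
        strict _ _ _ _ 1 (fun N => ⟨hP, fun hmem => ?_⟩) h one_pos
          (Or.inr ⟨tendsto_const_nhds, tendsto_const_nhds, by simpa using hscale⟩)⟩ <;>
      · have : 0 < 1 / √((N : ℝ) + 1) := by positivity
        linarith [hmem.2]
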